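/- Let $d\ge 1$ be an integer, $\tau>0$, and write $\tau=r+\nu$ with $r\in\{0,1,2,\dots\}$ and $\nu\in(0,1]$. Let $B\ge 0$. For $K\in\mathbb N$ let $\mathcal C_{\tau,d,K,B}$ be the class of maps $\kappa=(\kappa_1,\dots,\kappa_K):[0,1]^d\to\mathbb R^K$ with $\kappa_i\in C^r([0,1]^d)$ and, for every $i$, $$\max\Big\{\max_{|\alpha|\le r}\sup_{x\in[0,1]^d}|\partial^\alpha\kappa_i(x)|,\ \max_{|\alpha|=r}\ \sup_{x\ne y\in[0,1]^d}\frac{|\partial^\alpha\kappa_i(x)-\partial^\alpha\kappa_i(y)|}{|x-y|^\nu}\Big\}\le B,$$ where $|x-y|$ is the Euclidean distance. For integers $\mathcal W,\mathcal D\ge 0$ and a real $\mathcal M>0$ let $\mathcal F_{d,K}(\mathcal W,\mathcal D,\mathcal M)$ be the class of maps $\phi$ computed by a ReLU network with $\mathcal D$ hidden layers, $$\phi_0(x)=x,\qquad \phi_{i+1}(x)=\sigma(W_i\phi_i(x)+b_i)\ (0\le i<\mathcal D),\qquad \phi(x)=W_{\mathcal D}\,\phi_{\mathcal D}(x)+b_{\mathcal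 D},$$ with $\sigma(t)=\max(t,0)$ applied coordinatewise, input dimension $d$, output dimension $K$, at most $\mathcal W$ neurons in every hidden layer, and $$\|(W_{\mathcal D},b_{\mathcal D})\|\prod_{i=0}^{\mathcal D-1}\max\{\|(W_i,b_i)\|,1\}\le\mathcal M,$$ where $\|(W,b)\|=\max_k\big(\sum_j|W_{kj}|+|b_k|\big)$ is the maximal $\ell^1$-norm of a row. Theorem. There are constants $c,C>0$ depending only on $d,\tau,B$ such that for every $K$, every $\kappa\in\mathcal C_{\tau,d,K,B}$, every real $\mathcal M>0$ and all integers $\mathcal W,\mathcal D\ge 0$ with $$\mathcal W\ge c\,\mathcal M^{d/(d+1)}\log\mathcal M\quad\text{and}\quad \mathcal D\ge c\,\log\mathcal M,$$ there is $\phi\in\mathcal F_{d,K}(\mathcal W,\mathcal D,\mathcal M)$ with $$\|\kappa-\phi\|_{L^2([0,1]^d)}=\Big(\int_{[0,1]^d}\|\kappa(x)-\phi(x)\|_2^2\,dx\Big)^{1/2}\le C\,\sqrt K\,\mathcal M^{-\tau/(d+1)}.$$ -/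

import Mathlib

open scoped NNReal ENNReal
open MeasureTheory

noncomputable section

/-- The unit cube `[0,1]^d`. -/
def unitCube (d : ℕ) : Set (Fin d → ℝ) := Set.Icc 0 1

/-- The partial derivative `∂_{i₁} ⋯ ∂_{i_k} g` on the closed unit cube. For `g` of class `C^k` its
values, as `i` runs over all index tuples of length `k`, are exactly those of `∂^α g`, `|α| = k`. -/
def partialDeriv {d k : ℕ} (i : Fin k → Fin d) (g : (Fin d → ℝ) → ℝ) (x : Fin d → ℝ) : ℝ :=
  iteratedFDerivWithin ℝ k g (unitCube d) x (fun j => Pi.single (i j) 1)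

/-- The Hölder norm of order `r + ν` on `[0,1]^d`, with values in `[0, ∞]`: the maximum of the
suprema of all partial derivatives of order at most `r`, and of the `ν`-Hölder quotients (with
respect to the Euclidean distance) of those of order `r`. -/
def holderNorm {d : ℕ} (r : ℕ) (ν : ℝ) (g : (Fin d → ℝ) → ℝ) : ℝ≥0∞ :=
  max
    (⨆ (k : ℕ) (_ : k ≤ r) (i : Fin k → Fin d) (x ∈ unitCube d),
      ENNReal.ofReal |partialDeriv i g x|)
    (⨆ (i : Fin r → Fin d) (x ∈ unitCube d) (y ∈ unitCube d) (_ : x ≠ y),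
      ENNReal.ofReal
        (|partialDeriv i g x - partialDeriv i g y| / (√(∑ j, (x j - y j) ^ 2)) ^ ν))

/-- The class of maps `[0,1]^d → ℝ^K` all of whose components are of class `C^r` with Hölder norm
of order `r + ν` at most `B` (values outside of the cube are irrelevant). -/
def holderClass (r : ℕ) (ν : ℝ) (d K : ℕ) (B : ℝ≥0) : Set ((Fin d → ℝ) → Fin K → ℝ) :=
  {f | ∀ i, ContDiffOn ℝ r (fun x => f x i) (unitCube d) ∧ holderNorm r ν (fun x => f x i) ≤ B}

/-- Feed-forward ReLU networks with output dimension `K`, input dimension `d` (first index) and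
`D` hidden layers (second index), given by their weight matrices and bias vectors. -/
inductive ReLUNet (K : ℕ) : ℕ → ℕ → Type
  | output {d : ℕ} (W : Matrix (Fin K) (Fin d) ℝ) (b : Fin K → ℝ) : ReLUNet K d 0
  | hidden {d p D : ℕ} (W : Matrix (Fin p) (Fin d) ℝ) (b : Fin p → ℝ) (N : ReLUNet K p D) :
      ReLUNet K d (D + 1)

/-- The norm `‖(W, b)‖` of the matrix `W` augmented by the column `b`: the maximal `ℓ¹`-norm of a
row, which is the operator norm with respect to the sup norms (zero if there are no rows). -/
def augNorm {m n : ℕ} (W : Matrix (Fin m) (Fin n) ℝ) (b : Fin m → ℝ) : ℝ :=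
  ⨆ i, ((∑ j, |W i j|) + |b i|)

namespace ReLUNet

/-- The map computed by the network: `x ↦ σ(W x + b)` in each hidden layer, with
`σ(t) = max t 0` coordinatewise, and an affine map in the last layer. -/
def eval {K : ℕ} : {d D : ℕ} → ReLUNet K d D → (Fin d → ℝ) → Fin K → ℝ
  | _, _, output W b, x => W.mulVec x + b
  | _, _, hidden W b N, x => N.eval (fun i => max ((W.mulVec x + b) i) 0)

/-- The largest number of neurons in a hidden layer. -/
def width {K : ℕ} : {d D : ℕ} → ReLUNet K d D → ℕ
  | _, _, output _ _ => 0
  | _, _, hidden (p := p) _ _ N => max p N.width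

/-- `‖(W_D, b_D)‖ ∏_{i < D} max (‖(W_i, b_i)‖) 1`. -/
def normProd {K : ℕ} : {d D : ℕ} → ReLUNet K d D → ℝ
  | _, _, output W b => augNorm W b
  | _, _, hidden W b N => max (augNorm W b) 1 * N.normProd

end ReLUNet

/-- The norm-constrained class `F_{d,K}(W, D, M)`: maps computed by ReLU networks with `D` hidden
layers of width at most `W` and norm constraint `M`. -/
def reluClass (d K W D : ℕ) (M : ℝ) : Set ((Fin d → ℝ) → Fin K → ℝ) :=
  {φ | ∃ N : ReLUNet K d D, N.width ≤ W ∧ N.normProd ≤ M ∧ φ = N.eval}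

/-- The `L²([0,1]^d; ℝ^K)` norm, with the Euclidean norm on `ℝ^K`. -/
def l2CubeNorm {d K : ℕ} (g : (Fin d → ℝ) → Fin K → ℝ) : ℝ≥0∞ :=
  eLpNorm (fun x => WithLp.toLp 2 (g x) : (Fin d → ℝ) → EuclideanSpace ℝ (Fin K)) 2
    (volume.restrict (unitCube d))

end

/-! Localise `f` on a grid of mesh 1/N by tensor products of hat functions, replace it near each
grid point by its Taylor polynomial, and expand these polynomials in local Lagrange bases. This
gives error O(N^{-τ}) with O(N^d) basis functions, each a constant times a product of p = d(r+2)
piecewise linear factors.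

Products come from squares, and squares from repeated folding: j folds give accuracy 4^{-j} with
O(j) neurons and layers (`Realizable.exists_mul`). Norms are tracked by keeping every hidden layer
at norm at most one, which positive homogeneity permits; the whole norm is then the ℓ¹ norm of an
output row. Multiplying two functions costs O(j) times a common bound for their norms, not the
product of the norms, so a basis function has norm O(N j^p), still linear in N
(`exists_localBasis_approx`).

With N about M^{1/(d+1)} and j about log M, bounded coefficients would give norm N^{d+1} (log M)^p,
which exceeds M by the logarithms. The remedy is an expansion on two scales n and N = n²
(`HolderBound.exists_two_scale`): n^d bounded coefficients on the coarse grid, and a correction with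
coefficients O(n^{-τ}) on the fine one. Coarse hats are exact combinations of fine hats
(`tensorHat_refine`), so the sum is precisely the fine approximation. The coefficients now sum to
O(N^d n^{-θ}), θ = min(τ, 1), and the gain n^{-θ}, a negative power of M, absorbs (log M)^p once M
is large. For bounded M the zero network suffices.

The hidden layers depend only on the grids, so all K components share them (`Realizable.exists_sum`)
and the width does not involve K. -/

/-! ### Norm bookkeeping: affine combinations and layers of norm one -/

/-- `AffineComb S m f`: the function `f` is an affine combination of functions in `S` such that the
absolute values of the coefficients and of the constant term sum up to at most `m`. -/
inductive AffineComb {X : Type*} (S : Set (X → ℝ)) : ℝ → (X → ℝ) → Prop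
  | of {g : X → ℝ} (hg : g ∈ S) : AffineComb S 1 g
  | const (b : ℝ) : AffineComb S |b| (fun _ => b)
  | add {m n : ℝ} {f g : X → ℝ} (hf : AffineComb S m f) (hg : AffineComb S n g) :
      AffineComb S (m + n) (fun x => f x + g x)
  | smul (c : ℝ) {m : ℝ} {f : X → ℝ} (hf : AffineComb S m f) :
      AffineComb S (|c| * m) (fun x => c * f x)
  | mono {m n : ℝ} {f : X → ℝ} (hf : AffineComb S m f) (h : m ≤ n) : AffineComb S n f

namespace AffineComb

variable {X : Type*} {S T : Set (X → ℝ)} {m n : ℝ} {f g : X → ℝ}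

theorem subset (hf : AffineComb S m f) (h : S ⊆ T) : AffineComb T m f := by
  induction hf with
  | of hg => exact .of (h hg)
  | const b => exact .const b
  | add _ _ h1 h2 => exact h1.add h2
  | smul c _ h1 => exact h1.smul c
  | mono _ hmn h1 => exact h1.mono hmn

theorem const_of_le {b : ℝ} (h : |b| ≤ m) : AffineComb S m (fun _ => b) := (const b).mono h

theorem sub (hf : AffineComb S m f) (hg : AffineComb S n g) :
    AffineComb S (m + n) (fun x => f x - g x) := by
  have := hf.add (hg.smul (-1))
  simpa [sub_eq_add_neg] using this

theorem sum {ι : Type*} (s : Finset ι) {m : ι → ℝ} {f : ι → X → ℝ}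
    (h : ∀ i ∈ s, AffineComb S (m i) (f i)) :
    AffineComb S (∑ i ∈ s, m i) (fun x => ∑ i ∈ s, f i x) := by
  classical
  induction s using Finset.induction_on with
  | empty => simpa using const_of_le (S := S) (b := 0) (m := 0) (by simp)
  | insert a s ha ih =>
    simp only [Finset.sum_insert ha]
    exact (h a (by simp)).add (ih fun i hi => h i (by simp [hi]))

/-- Coefficients of an affine combination of a finite family. -/
theorem exists_coeff {p : ℕ} {Φ : Fin p → X → ℝ} (hS : Set.range Φ = S)
    (hf : AffineComb S m f) :
    ∃ (a : Fin p → ℝ) (b : ℝ), (∑ i, |a i|) + |b| ≤ m ∧ f = fun x => ∑ i, a i * Φ i x + b := by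
  induction hf with
  | of hg =>
    subst hS
    obtain ⟨i, rfl⟩ := hg
    refine ⟨Pi.single i 1, 0, ?_, ?_⟩
    · rw [Finset.sum_eq_single i] <;> simp +contextual
    · funext x
      rw [Finset.sum_eq_single i] <;> simp +contextual
  | const b => exact ⟨0, b, by simp, by simp⟩
  | add _ _ h1 h2 =>
    obtain ⟨a, b, h, rfl⟩ := h1
    obtain ⟨a', b', h', rfl⟩ := h2
    refine ⟨a + a', b + b', ?_, ?_⟩
    · have := Finset.sum_le_sum fun i (_ : i ∈ Finset.univ) => abs_add_le (a i) (a' i)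
      rw [Finset.sum_add_distrib] at this
      have := abs_add_le b b'
      simp only [Pi.add_apply]
      linarith
    · funext x
      simp only [Pi.add_apply, add_mul, Finset.sum_add_distrib]
      ring
  | smul c _ h1 =>
    obtain ⟨a, b, h, rfl⟩ := h1
    refine ⟨fun i => c * a i, c * b, ?_, ?_⟩
    · simp only [abs_mul, ← Finset.mul_sum, ← mul_add]
      exact mul_le_mul_of_nonneg_left h (abs_nonneg c)
    · funext x
      simp only [mul_add, Finset.mul_sum, mul_assoc]
  | mono _ hmn h1 =>
    obtain ⟨a, b, h, rfl⟩ := h1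
    exact ⟨a, b, h.trans hmn, rfl⟩

end AffineComb

/-- `Realizable w D S`: the functions in `S` are the outputs of the neurons of the `D`-th layer of a
ReLU network of width at most `w` all of whose layers have norm at most one. The layer with number
zero consists of the coordinates. -/
inductive Realizable {d : ℕ} (w : ℕ) : ℕ → Set ((Fin d → ℝ) → ℝ) → Prop
  | input : Realizable w 0 (Set.range fun i x => x i)
  | layer {D : ℕ} {S T : Set ((Fin d → ℝ) → ℝ)} (hS : Realizable w D S) (hT : T.encard ≤ w)
      (h : ∀ f ∈ T, ∃ g, AffineComb S 1 g ∧ f = fun x => max (g x) 0) : Realizable w (D + 1) T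

namespace Realizable

variable {d : ℕ} {w v D : ℕ} {S T : Set ((Fin d → ℝ) → ℝ)}

theorem mono (hS : Realizable w D S) (h : w ≤ v) : Realizable v D S := by
  induction hS with
  | input => exact input
  | layer _ hT hg ih => exact ih.layer (hT.trans (by exact_mod_cast h)) hg

theorem union (hS : Realizable w D S) (hT : Realizable v D T) : Realizable (w + v) D (S ∪ T) := by
  induction hS generalizing T with
  | input =>
    cases hT
    rw [Set.union_self]
    exact input
  | layer _ hc hg ih =>
    cases hT with
    | layer h1 hc' hg' =>
      refine (ih h1).layer ((Set.encard_union_le _ _).trans ?_) ?_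
      · push_cast
        exact add_le_add hc hc'
      · rintro f (hf | hf)
        · obtain ⟨g, hg, rfl⟩ := hg f hf
          exact ⟨g, hg.subset Set.subset_union_left, rfl⟩
        · obtain ⟨g, hg, rfl⟩ := hg' f hf
          exact ⟨g, hg.subset Set.subset_union_right, rfl⟩

theorem empty (w D : ℕ) : Realizable w (D + 1) (∅ : Set ((Fin d → ℝ) → ℝ)) := by
  induction D with
  | zero => exact input.layer (by simp) (by simp)
  | succ D ih => exact ih.layer (by simp) (by simp)

/-- Stated from layer one on: layer zero always consists of all coordinates, so an empty union is
not available there. -/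
theorem iUnion {ι : Type*} (s : Finset ι) {S : ι → Set ((Fin d → ℝ) → ℝ)}
    (h : ∀ i ∈ s, Realizable w (D + 1) (S i)) :
    Realizable (s.card * w) (D + 1) (⋃ i ∈ s, S i) := by
  classical
  induction s using Finset.induction_on with
  | empty => simpa using empty 0 D
  | insert a s ha ih =>
    rw [Finset.set_biUnion_insert, Finset.card_insert_of_notMem ha, add_mul, one_mul, add_comm]
    exact (h a (by simp)).union (ih fun i hi => h i (by simp [hi]))

theorem nonneg (hS : Realizable w (D + 1) S) {f : (Fin d → ℝ) → ℝ} (hf : f ∈ S) (x : Fin d → ℝ) :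
    0 ≤ f x := by
  cases hS with
  | layer _ _ h =>
    obtain ⟨g, -, rfl⟩ := h f hf
    exact le_max_right _ _

theorem encard_le (hS : Realizable w (D + 1) S) : S.encard ≤ w := by
  cases hS with
  | layer _ h _ => exact h

/-- Outputs of ReLU neurons are nonnegative, hence fixed by another ReLU: depth can be padded
without extra width or norm. -/
theorem succ (hS : Realizable w (D + 1) S) : Realizable w (D + 1 + 1) S :=
  hS.layer hS.encard_le fun f hf => ⟨f, .of hf, by
    funext x
    exact (max_eq_left (hS.nonneg hf x)).symm⟩

theorem of_le {E : ℕ} (hS : Realizable w (D + 1) S) (h : D + 1 ≤ E) : Realizable w E S := by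
  obtain ⟨k, rfl⟩ := Nat.exists_eq_add_of_le h
  induction k with
  | zero => exact hS
  | succ k ih =>
    have := ih (by omega)
    rw [show D + 1 + k = D + k + 1 by omega] at this
    rw [show D + 1 + (k + 1) = D + k + 1 + 1 by omega]
    exact this.succ

/-- One more layer suffices to compute the absolute value of a combination of neurons, keeping all
neurons of the present layer. -/
theorem exists_abs (hS : Realizable w (D + 1) S) {m : ℝ} (hm : 0 < m) {f : (Fin d → ℝ) → ℝ}
    (hf : AffineComb S m f) :
    ∃ T, S ⊆ T ∧ Realizable (w + 2) (D + 1 + 1) T ∧ AffineComb T (2 * m) (fun x => |f x|) := by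
  -- Dividing by `m` keeps the new layer at norm one; the factor `m` reappears in the output
  -- coefficients.
  let p : (Fin d → ℝ) → ℝ := fun x => max (m⁻¹ * f x) 0
  let q : (Fin d → ℝ) → ℝ := fun x => max (-m⁻¹ * f x) 0
  refine ⟨S ∪ {p, q}, Set.subset_union_left, ?_, ?_⟩
  · refine (hS.mono (Nat.le_add_right w 2)).layer ((Set.encard_union_le _ _).trans ?_) ?_
    · push_cast
      refine add_le_add hS.encard_le ((Set.encard_insert_le _ _).trans ?_)
      rw [Set.encard_singleton]
      norm_num
    · rintro g (hg | rfl | rfl)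
      · exact ⟨g, .of hg, by
          funext x
          exact (max_eq_left (hS.nonneg hg x)).symm⟩
      · exact ⟨_, (hf.smul m⁻¹).mono (by rw [abs_of_pos (by positivity), inv_mul_cancel₀ hm.ne']),
          rfl⟩
      · exact ⟨_, (hf.smul (-m⁻¹)).mono (by
          rw [abs_neg, abs_of_pos (by positivity), inv_mul_cancel₀ hm.ne']), rfl⟩
  · have hp : p ∈ S ∪ {p, q} := by simp
    have hq : q ∈ S ∪ {p, q} := by simp
    convert (((AffineComb.of hp).smul m).add ((AffineComb.of hq).smul m)).mono
      (n := 2 * m) (by rw [abs_of_pos hm]; linarith) using 2 with x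
    simp only [p, q]
    have h := max_zero_add_max_neg_zero_eq_abs_self (m⁻¹ * f x)
    rw [← mul_add, neg_mul, h, abs_mul, abs_of_pos (inv_pos.2 hm), mul_inv_cancel_left₀ hm.ne']

end Realizable

theorem augNorm_le {m n : ℕ} {W : Matrix (Fin m) (Fin n) ℝ} {b : Fin m → ℝ} {a : ℝ} (ha : 0 ≤ a)
    (h : ∀ i, (∑ j, |W i j|) + |b i| ≤ a) : augNorm W b ≤ a :=
  Real.iSup_le h ha

/-- A network on top of a realizable layer is a network. -/
theorem Realizable.exists_reLUNet {d w D : ℕ} {S : Set ((Fin d → ℝ) → ℝ)}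
    (hS : Realizable w D S) :
    ∃ (p : ℕ) (Φ : Fin p → (Fin d → ℝ) → ℝ), Set.range Φ = S ∧
      ∀ {K E F : ℕ} (N : ReLUNet K p E), N.width ≤ w → 0 ≤ N.normProd → F = D + E →
        ∃ N' : ReLUNet K d F, N'.width ≤ w ∧ N'.normProd ≤ N.normProd ∧
          N'.eval = fun x => N.eval (fun i => Φ i x) := by
  induction hS with
  | input =>
    refine ⟨d, fun i x => x i, rfl, ?_⟩
    intro K E F N hN h0 hF
    obtain rfl : F = E := by omega
    exact ⟨N, hN, le_rfl, rfl⟩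
  | @layer D S T _ hT h ih =>
    obtain ⟨p, Φ, hΦ, ih⟩ := ih
    have hfin : T.Finite := Set.finite_of_encard_le_coe hT
    have := hfin.to_subtype
    have hcard : Nat.card T ≤ w := by
      rw [← hfin.cast_ncard_eq] at hT
      exact_mod_cast hT
    choose g hg hTg using h
    obtain ⟨e⟩ : Nonempty (Fin (Nat.card T) ≃ T) := ⟨(Finite.equivFin T).symm⟩
    have hc : ∀ i : Fin (Nat.card T), ∃ (a : Fin p → ℝ) (b : ℝ), (∑ j, |a j|) + |b| ≤ 1 ∧
        g (e i) (e i).2 = fun x => ∑ j, a j * Φ j x + b :=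
      fun i => (hg (e i) (e i).2).exists_coeff hΦ
    choose A b hAb hgA using hc
    refine ⟨Nat.card T, fun i => e i, ?_, ?_⟩
    · ext f
      constructor
      · rintro ⟨i, rfl⟩
        exact (e i).2
      · intro hf
        exact ⟨e.symm ⟨f, hf⟩, congrArg Subtype.val (e.apply_symm_apply _)⟩
    · intro K E F N hN h0 hF
      have hone : max (augNorm (Matrix.of A) b) 1 = 1 :=
        max_eq_right (augNorm_le zero_le_one hAb)
      -- The last realizable layer becomes the first layer of the network on top; its norm is at
      -- most one, so it leaves the product unchanged.
      obtain ⟨N', h1, h2, h3⟩ := ih (F := F) (.hidden (Matrix.of A) b N)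
        (by simp only [ReLUNet.width]; exact max_le hcard hN)
        (by simp only [ReLUNet.normProd, hone, one_mul]; exact h0) (by omega)
      refine ⟨N', h1, ?_, ?_⟩
      · simpa only [ReLUNet.normProd, hone, one_mul] using h2
      · rw [h3]
        funext x
        simp only [ReLUNet.eval]
        congr 1
        funext i
        rw [hTg _ (e i).2, hgA]
        rfl

/-- Functions that are combinations of the neurons of a realizable layer are computed by a
norm-constrained network. -/
theorem Realizable.exists_mem_reluClass {d w D K : ℕ} {S : Set ((Fin d → ℝ) → ℝ)}
    (hS : Realizable w D S) {m : ℝ} (hm : 0 ≤ m) {f : Fin K → (Fin d → ℝ) → ℝ}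
    (hf : ∀ i, AffineComb S m (f i)) : (fun x i => f i x) ∈ reluClass d K w D m := by
  obtain ⟨p, Φ, hΦ, h⟩ := hS.exists_reLUNet
  choose A b hAb hfA using fun i => (hf i).exists_coeff hΦ
  obtain ⟨N', h1, h2, h3⟩ := h (F := D) (.output (Matrix.of A) b) (by simp [ReLUNet.width])
    (by
      simp only [ReLUNet.normProd]
      exact Real.iSup_nonneg fun i => by positivity) rfl
  refine ⟨N', h1, h2.trans ?_, ?_⟩
  · simp only [ReLUNet.normProd]
    exact augNorm_le hm hAb
  · rw [h3]
    funext x i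
    simp [ReLUNet.eval, hfA, Matrix.mulVec_eq_sum, mul_comm]

theorem zero_mem_reluClass {d K W D : ℕ} {M : ℝ} (hM : 0 ≤ M) :
    (fun _ _ => 0) ∈ reluClass d K W D M := by
  have h0 : ∀ S : Set ((Fin d → ℝ) → ℝ), AffineComb S M (fun _ => 0) := fun S =>
    AffineComb.const_of_le (by simpa using hM)
  cases D with
  | zero => exact Realizable.input.exists_mem_reluClass hM fun _ => h0 _
  | succ D => exact (Realizable.empty W D).exists_mem_reluClass hM fun _ => h0 _

/-! ### Squaring and multiplication by folding -/

/-- Piecewise linear approximation of `v ^ 2` on `[0, 1]`, given by `j`-fold folding. -/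
noncomputable def foldSq : ℕ → ℝ → ℝ
  | 0, v => v
  -- Modelled on v² = v - 1/4 + |2v - 1|²/4, so each fold divides the error by four.
  | j + 1, v => v - 1 / 4 + foldSq j |2 * v - 1| / 4

theorem abs_two_mul_sub_one_mem {v : ℝ} (h0 : 0 ≤ v) (h1 : v ≤ 1) : |2 * v - 1| ≤ 1 :=
  abs_le.2 ⟨by linarith, by linarith⟩

theorem foldSq_le (j : ℕ) {v : ℝ} (h0 : 0 ≤ v) (h1 : v ≤ 1) : foldSq j v ≤ v := by
  induction j generalizing v with
  | zero => exact le_rfl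
  | succ j ih =>
    have h2 := abs_two_mul_sub_one_mem h0 h1
    have := ih (abs_nonneg (2 * v - 1)) h2
    simp only [foldSq]
    linarith

theorem sq_le_foldSq (j : ℕ) {v : ℝ} (h0 : 0 ≤ v) (h1 : v ≤ 1) : v ^ 2 ≤ foldSq j v := by
  induction j generalizing v with
  | zero => simp only [foldSq]; nlinarith
  | succ j ih =>
    have h2 := abs_two_mul_sub_one_mem h0 h1
    have := ih (abs_nonneg (2 * v - 1)) h2
    simp only [foldSq]
    rw [sq_abs] at this
    nlinarith

theorem foldSq_sub_sq_le (j : ℕ) {v : ℝ} (h0 : 0 ≤ v) (h1 : v ≤ 1) :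
    foldSq j v - v ^ 2 ≤ (1 / 4) ^ j := by
  induction j generalizing v with
  | zero => simp only [foldSq, pow_zero]; nlinarith
  | succ j ih =>
    have h2 := abs_two_mul_sub_one_mem h0 h1
    have := ih (abs_nonneg (2 * v - 1)) h2
    simp only [foldSq]
    rw [sq_abs] at this
    rw [pow_succ (1 / 4 : ℝ)]
    nlinarith

namespace Realizable

variable {d : ℕ} {w D : ℕ} {S : Set ((Fin d → ℝ) → ℝ)}

/-- Folding enlarges the norm from m to 4m + 1, but the recursion weighs the folded term by 1/4. The
norm therefore grows linearly, not exponentially, in `j`. -/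
theorem exists_foldSq (hS : Realizable w (D + 1) S) (j : ℕ) {m : ℝ} (hm : 0 < m)
    {f : (Fin d → ℝ) → ℝ} (hf : AffineComb S m f) :
    ∃ T, S ⊆ T ∧ Realizable (w + 2 * (j + 1)) (D + 1 + (j + 1)) T ∧
      AffineComb T (2 * (j + 1) * m + (j + 1)) (fun x => foldSq j |f x|) := by
  induction j generalizing w D S m f with
  | zero =>
    obtain ⟨T, h1, h2, h3⟩ := hS.exists_abs hm hf
    exact ⟨T, h1, h2, h3.mono (by push_cast; linarith)⟩
  | succ j ih =>
    obtain ⟨T, h1, h2, h3⟩ := hS.exists_abs hm hf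
    have h4 : AffineComb T (4 * m + 1) (fun x => 2 * |f x| - 1) :=
      ((h3.smul 2).sub (.const 1)).mono (by norm_num; linarith)
    obtain ⟨T', h1', h2', h3'⟩ := ih h2 (by positivity) h4
    refine ⟨T', h1.trans h1', ?_, ?_⟩
    · rw [show w + 2 * (j + 1 + 1) = w + 2 + 2 * (j + 1) by ring,
        show D + 1 + (j + 1 + 1) = D + 1 + 1 + (j + 1) by ring]
      exact h2'
    · have h5 := ((h3.subset h1').sub (.const (1 / 4))).add (h3'.smul (1 / 4))
      convert h5.mono (n := 2 * ((j + 1 : ℕ) + 1) * m + ((j + 1 : ℕ) + 1)) ?_ using 2 with x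
      · simp only [foldSq]
        ring
      · push_cast
        norm_num
        have : (0 : ℝ) ≤ j := Nat.cast_nonneg j
        nlinarith

/-- Approximate multiplication. -/
theorem exists_mul (hS : Realizable w (D + 1) S) (j : ℕ) {m : ℝ} (hm : 1 ≤ m)
    {f g : (Fin d → ℝ) → ℝ} (hf : AffineComb S m f) (hg : AffineComb S m g)
    (hf1 : ∀ x, |f x| ≤ 1) (hg1 : ∀ x, |g x| ≤ 1) :
    ∃ T, S ⊆ T ∧ Realizable (w + 4 * (j + 1)) (D + 1 + 2 * (j + 1)) T ∧
      ∃ P, AffineComb T (6 * (j + 1) * m) P ∧ (∀ x, |P x| ≤ 1) ∧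
        ∀ x, |P x - f x * g x| ≤ (1 / 4) ^ j := by
  have hp : AffineComb S m (fun x => 1 / 2 * (f x + g x)) :=
    ((hf.add hg).smul (1 / 2)).mono (by norm_num; linarith)
  have hq : AffineComb S m (fun x => 1 / 2 * (f x - g x)) :=
    ((hf.sub hg).smul (1 / 2)).mono (by norm_num; linarith)
  obtain ⟨T, h1, h2, h3⟩ := hS.exists_foldSq j (by linarith) hp
  rw [show D + 1 + (j + 1) = D + j + 1 + 1 by ring] at h2
  obtain ⟨T', h1', h2', h3'⟩ := h2.exists_foldSq j (by linarith) (hq.subset h1)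
  have hp1 : ∀ x, |1 / 2 * (f x + g x)| ≤ 1 := fun x => by
    have h5 := abs_le.1 (hf1 x)
    have h6 := abs_le.1 (hg1 x)
    exact abs_le.2 ⟨by linarith, by linarith⟩
  have hq1 : ∀ x, |1 / 2 * (f x - g x)| ≤ 1 := fun x => by
    have h5 := abs_le.1 (hf1 x)
    have h6 := abs_le.1 (hg1 x)
    exact abs_le.2 ⟨by linarith, by linarith⟩
  refine ⟨T', h1.trans h1', ?_, _, ((h3.subset h1').sub h3').mono ?_, fun x => ?_, fun x => ?_⟩
  · rw [show w + 4 * (j + 1) = w + 2 * (j + 1) + 2 * (j + 1) by ring,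
      show D + 1 + 2 * (j + 1) = D + j + 1 + 1 + (j + 1) by ring]
    exact h2'
  · have : (0 : ℝ) ≤ j := Nat.cast_nonneg j
    nlinarith
  -- A difference of two numbers in [0, 1]: the bound by one survives, so the multiplication can be
  -- iterated.
  · have a1 := foldSq_le j (abs_nonneg _) (hp1 x)
    have a2 := sq_le_foldSq j (abs_nonneg _) (hp1 x)
    have b1 := foldSq_le j (abs_nonneg _) (hq1 x)
    have b2 := sq_le_foldSq j (abs_nonneg _) (hq1 x)
    have c1 := hp1 x
    have c2 := hq1 x
    have e1 := sq_nonneg |1 / 2 * (f x + g x)|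
    have e2 := sq_nonneg |1 / 2 * (f x - g x)|
    exact abs_le.2 ⟨by linarith, by linarith⟩
  · have a1 := foldSq_sub_sq_le j (abs_nonneg _) (hp1 x)
    have a2 := sq_le_foldSq j (abs_nonneg _) (hp1 x)
    have b1 := foldSq_sub_sq_le j (abs_nonneg _) (hq1 x)
    have b2 := sq_le_foldSq j (abs_nonneg _) (hq1 x)
    -- Polarisation.
    have hfg : f x * g x = |1 / 2 * (f x + g x)| ^ 2 - |1 / 2 * (f x - g x)| ^ 2 := by
      rw [sq_abs, sq_abs]
      ring
    rw [hfg]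
    exact abs_le.2 ⟨by linarith, by linarith⟩

/-- Approximate multiplication of finitely many factors. -/
theorem exists_prod (hS : Realizable w (D + 1) S) (j : ℕ) {m : ℝ} (hm : 1 ≤ m)
    {ι : Type*} (s : Finset ι) {f : ι → (Fin d → ℝ) → ℝ} (hf : ∀ i ∈ s, AffineComb S m (f i))
    (hf1 : ∀ i ∈ s, ∀ x, |f i x| ≤ 1) :
    ∃ T, S ⊆ T ∧ Realizable (w + s.card * (4 * (j + 1))) (D + 1 + s.card * (2 * (j + 1))) T ∧
      ∃ P, AffineComb T ((6 * (j + 1)) ^ s.card * m) P ∧ (∀ x, |P x| ≤ 1) ∧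
        ∀ x, |P x - ∏ i ∈ s, f i x| ≤ s.card * (1 / 4) ^ j := by
  classical
  induction s using Finset.induction_on with
  | empty =>
    refine ⟨S, subset_rfl, by simpa using hS, fun _ => 1, ?_, by simp, by simp⟩
    exact AffineComb.const_of_le (by simpa using hm)
  | insert a s ha ih =>
    obtain ⟨T, h1, h2, P, h3, h4, h5⟩ := ih (fun i hi => hf i (by simp [hi]))
      (fun i hi => hf1 i (by simp [hi]))
    have hj : (0 : ℝ) ≤ j := Nat.cast_nonneg j
    have hL : (1 : ℝ) ≤ (6 * (j + 1)) ^ s.card := one_le_pow₀ (by linarith)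
    rw [show D + 1 + s.card * (2 * (j + 1)) = D + s.card * (2 * (j + 1)) + 1 by ring] at h2
    -- The next factor is only raised to the norm bound of the partial product, so `m` enters the
    -- final norm just once.
    have hfa : AffineComb T ((6 * (j + 1)) ^ s.card * m) (f a) :=
      ((hf a (by simp)).subset h1).mono (le_mul_of_one_le_left (by linarith) hL)
    obtain ⟨T', h1', h2', Q, h3', h4', h5'⟩ := h2.exists_mul j
      (one_le_mul_of_one_le_of_one_le hL hm) hfa h3 (hf1 a (by simp)) h4
    rw [Finset.card_insert_of_notMem ha]
    refine ⟨T', h1.trans h1', ?_, Q, ?_, h4', fun x => ?_⟩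
    · rw [show w + (s.card + 1) * (4 * (j + 1)) = w + s.card * (4 * (j + 1)) + 4 * (j + 1) by ring,
        show D + 1 + (s.card + 1) * (2 * (j + 1)) = D + s.card * (2 * (j + 1)) + 1 + 2 * (j + 1)
          by ring]
      exact h2'
    · exact h3'.mono (by rw [pow_succ]; linarith)
    · rw [Finset.prod_insert ha]
      have e1 := h5' x
      have e2 := h5 x
      have e3 : |f a x * (P x - ∏ i ∈ s, f i x)| ≤ s.card * (1 / 4) ^ j := by
        rw [abs_mul]
        exact (mul_le_of_le_one_left (abs_nonneg _) (hf1 a (by simp) x)).trans e2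
      calc _ = |(Q x - f a x * P x) + f a x * (P x - ∏ i ∈ s, f i x)| := by ring_nf
        _ ≤ _ := abs_add_le _ _
        _ ≤ (1 / 4) ^ j + s.card * (1 / 4) ^ j := add_le_add e1 e3
        _ = _ := by push_cast; ring

end Realizable

/-! ### Hat functions, partition of unity and grid refinement -/

/-- The hat function, supported on `[-1, 1]`. -/
noncomputable def hat (t : ℝ) : ℝ := max (1 - |t|) 0

theorem hat_nonneg (t : ℝ) : 0 ≤ hat t := le_max_right _ _

theorem hat_le_one (t : ℝ) : hat t ≤ 1 := max_le (by linarith [abs_nonneg t]) zero_le_one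

theorem abs_lt_one_of_hat_ne_zero {t : ℝ} (h : hat t ≠ 0) : |t| < 1 := by
  by_contra hc
  exact h (max_eq_right (by linarith))

theorem hat_of_nonneg {t : ℝ} (h0 : 0 ≤ t) (h1 : t ≤ 1) : hat t = 1 - t := by
  rw [hat, abs_of_nonneg h0, max_eq_left (by linarith)]

theorem hat_of_nonpos {t : ℝ} (h0 : t ≤ 0) (h1 : -1 ≤ t) : hat t = 1 + t := by
  rw [hat, abs_of_nonpos h0, max_eq_left (by linarith)]
  ring

theorem hat_of_one_le {t : ℝ} (h : 1 ≤ |t|) : hat t = 0 := max_eq_right (by linarith)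

theorem hat_eq_relu (t : ℝ) : hat t = max (t + 1) 0 - 2 * max t 0 + max (t - 1) 0 := by
  simp only [hat]
  rcases abs_cases t with h | h <;> grind

/-- The hat function is affine on every interval between consecutive integers. -/
theorem hat_affine (i : ℤ) {s t z : ℝ} (hs : (i : ℝ) ≤ s) (hs1 : s ≤ i + 1) (ht : (i : ℝ) ≤ t)
    (ht1 : t ≤ i + 1) (hz : 0 ≤ z) (hz1 : z ≤ 1) :
    hat ((1 - z) * s + z * t) = (1 - z) * hat s + z * hat t := by
  have hu : (i : ℝ) ≤ (1 - z) * s + z * t := by nlinarith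
  have hu1 : (1 - z) * s + z * t ≤ i + 1 := by nlinarith
  rcases lt_trichotomy i (-1) with hi | rfl | hi
  · have : (i : ℝ) ≤ -2 := by exact_mod_cast (by omega : i ≤ -2)
    rw [hat_of_one_le (t := s), hat_of_one_le (t := t), hat_of_one_le]
    · ring
    all_goals exact le_abs.2 (Or.inr (by linarith))
  · push_cast at *
    rw [hat_of_nonpos, hat_of_nonpos, hat_of_nonpos]
    · ring
    all_goals linarith
  · rcases (by omega : i = 0 ∨ 1 ≤ i) with rfl | hi
    · push_cast at *
      rw [hat_of_nonneg, hat_of_nonneg, hat_of_nonneg]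
      · ring
      all_goals linarith
    · have : (1 : ℝ) ≤ i := by exact_mod_cast hi
      rw [hat_of_one_le (t := s), hat_of_one_le (t := t), hat_of_one_le]
      · ring
      all_goals exact le_abs.2 (Or.inl (by linarith))

/-- Piecewise linear functions are reproduced by hat functions. -/
theorem sum_hat_mul {N : ℕ} (hN : 1 ≤ N) {g : ℝ → ℝ}
    (hg : ∀ k : ℕ, ∀ z : ℝ, 0 ≤ z → z ≤ 1 →
      g ((k + z) / N) = (1 - z) * g (k / N) + z * g ((k + 1) / N))
    {t : ℝ} (ht : 0 ≤ t) (ht1 : t ≤ 1) :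
    ∑ k : Fin (N + 1), hat (N * t - (k : ℕ)) * g ((k : ℕ) / N) = g t := by
  rw [Fin.sum_univ_eq_sum_range (fun k => hat (N * t - k) * g (k / N))]
  have hN0 : (0 : ℝ) < N := by exact_mod_cast hN
  have hNt : 0 ≤ N * t := by positivity
  obtain ⟨m, hm, hm0, hm1⟩ : ∃ m : ℕ, m < N ∧ (m : ℝ) ≤ N * t ∧ N * t ≤ m + 1 := by
    rcases lt_or_ge ⌊N * t⌋₊ N with h | h
    · exact ⟨_, h, Nat.floor_le hNt, (Nat.lt_floor_add_one _).le⟩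
    · have h1 : (N : ℝ) ≤ N * t := (Nat.cast_le.2 h).trans (Nat.floor_le hNt)
      -- At t = 1 the floor is `N`, which starts no cell; the last cell is used instead.
      refine ⟨N - 1, by omega, ?_, ?_⟩ <;> rw [Nat.cast_sub hN] <;> push_cast <;> nlinarith
  rw [Finset.sum_eq_add m (m + 1) (by omega)]
  · have h1 := hg m (N * t - m) (by linarith) (by linarith)
    rw [add_sub_cancel, mul_div_cancel_left₀ _ hN0.ne'] at h1
    rw [h1, hat_of_nonneg (by linarith) (by linarith), hat_of_nonpos]
    · push_cast
      ring
    all_goals push_cast; linarith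
  · intro k _ hk
    rw [hat_of_one_le, zero_mul]
    rcases (by omega : k + 1 ≤ m ∨ m + 2 ≤ k) with h | h
    · have : (k : ℝ) + 1 ≤ m := by exact_mod_cast h
      exact le_abs.2 (Or.inl (by linarith))
    · have : (m : ℝ) + 2 ≤ k := by exact_mod_cast h
      exact le_abs.2 (Or.inr (by linarith))
  · intro h
    exact absurd (Finset.mem_range.2 (by omega)) h
  · intro h
    exact absurd (Finset.mem_range.2 (by omega)) h

/-- Each cell of the fine grid lies in one cell of the coarse grid, found by integer division `k /
q`, and the coarse hat is affine there. -/
theorem hat_refine {n q : ℕ} (hn : 1 ≤ n) (hq : 1 ≤ q) (j k : ℕ) {z : ℝ} (hz : 0 ≤ z)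
    (hz1 : z ≤ 1) :
    hat (n * ((k + z) / (n * q : ℕ)) - j) = (1 - z) * hat (n * (k / (n * q : ℕ)) - j) +
      z * hat (n * ((k + 1) / (n * q : ℕ)) - j) := by
  have hn0 : (n : ℝ) ≠ 0 := by positivity
  have hq0 : (0 : ℝ) < q := by exact_mod_cast hq
  have e : ∀ s : ℝ, (n : ℝ) * (s / (n * q : ℕ)) = s / q := fun s => by
    push_cast
    field_simp
  simp only [e]
  have h1 : ((k / q : ℕ) : ℝ) ≤ k / q := Nat.cast_div_le
  have h2 : ((k : ℝ) + 1) / q ≤ (k / q : ℕ) + 1 := by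
    rw [div_le_iff₀ hq0]
    exact_mod_cast Nat.lt_div_mul_add (a := k) hq |>.trans_eq (by ring)
  have h3 : (k : ℝ) / q ≤ (k + 1) / q := by gcongr; linarith
  have hi : ((((k / q : ℕ) : ℤ) - (j : ℤ) : ℤ) : ℝ) = (k / q : ℕ) - j := by
    simp only [Int.cast_sub, Int.cast_natCast]
  have := hat_affine (((k / q : ℕ) : ℤ) - (j : ℤ)) (s := k / q - j) (t := (k + 1) / q - j)
    (by linarith) (by linarith) (by linarith) (by linarith) hz hz1
  rw [← this]
  congr 1
  field_simp
  ring

/-- Tensor products of hat functions. -/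
noncomputable def tensorHat {d : ℕ} (N : ℕ) (k : Fin d → ℕ) (x : Fin d → ℝ) : ℝ :=
  ∏ c, hat (N * x c - k c)

/-- The grid of points with coordinates in `{0, …, N}`. -/
abbrev Grid (d N : ℕ) : Type := Fin d → Fin (N + 1)

theorem tensorHat_nonneg {d N : ℕ} (k : Fin d → ℕ) (x : Fin d → ℝ) : 0 ≤ tensorHat N k x :=
  Finset.prod_nonneg fun _ _ => hat_nonneg _

theorem abs_lt_one_of_tensorHat_ne_zero {d N : ℕ} {k : Fin d → ℕ} {x : Fin d → ℝ}
    (h : tensorHat N k x ≠ 0) (c : Fin d) : |N * x c - k c| < 1 :=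
  abs_lt_one_of_hat_ne_zero fun h0 => h (Finset.prod_eq_zero (Finset.mem_univ c) h0)

theorem sum_tensorHat_mul {d N : ℕ} (hN : 1 ≤ N) {g : Fin d → ℝ → ℝ}
    (hg : ∀ c, ∀ k : ℕ, ∀ z : ℝ, 0 ≤ z → z ≤ 1 →
      g c ((k + z) / N) = (1 - z) * g c (k / N) + z * g c ((k + 1) / N))
    {x : Fin d → ℝ} (hx : x ∈ unitCube d) :
    ∑ k : Grid d N, tensorHat N (fun c => k c) x * ∏ c, g c ((k c : ℕ) / N) = ∏ c, g c (x c) := by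
  have h := fun c => sum_hat_mul hN (hg c) (hx.1 c) (hx.2 c)
  simp only [← h, Finset.prod_univ_sum, Fintype.piFinset_univ, tensorHat, Finset.prod_mul_distrib]

theorem sum_tensorHat {d N : ℕ} (hN : 1 ≤ N) {x : Fin d → ℝ} (hx : x ∈ unitCube d) :
    ∑ k : Grid d N, tensorHat N (fun c => k c) x = 1 := by
  have := sum_tensorHat_mul hN (g := fun _ _ => 1) (fun c k z _ _ => by ring) hx
  simpa using this

/-- A coarse tensor hat is a product of functions affine on the fine cells, hence equals its own
fine interpolant. -/
theorem tensorHat_refine {d n q : ℕ} (hn : 1 ≤ n) (hq : 1 ≤ q) (j : Fin d → ℕ)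
    {x : Fin d → ℝ} (hx : x ∈ unitCube d) :
    ∑ k : Grid d (n * q), tensorHat (n * q) (fun c => k c) x *
      tensorHat n j (fun c => (k c : ℕ) / (n * q : ℕ)) = tensorHat n j x :=
  sum_tensorHat_mul (Nat.mul_pos hn hq) (g := fun c t => hat (n * t - j c))
    (fun c k _ hz hz1 => hat_refine hn hq (j c) k hz hz1) hx

/-! ### Local Lagrange bases -/

/-- Interpolation nodes in an interval of length `1 / N` adjacent to `k / N`. -/
noncomputable def lagNode (N r k : ℕ) (b : Fin (r + 1)) : ℝ :=
  -- For k = N the nodes are taken from the last cell, so that they stay in [0, 1].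
  ((min k (N - 1) : ℕ) + (b : ℕ) / (r + 1)) / N

/-- The Lagrange basis polynomials for the nodes `lagNode`. -/
noncomputable def lagBasis (N r k : ℕ) (a : Fin (r + 1)) (t : ℝ) : ℝ :=
  ∏ b ∈ Finset.univ.erase a, (lagNode N r k a - lagNode N r k b)⁻¹ * (t - lagNode N r k b)

theorem lagNode_injective {N : ℕ} (hN : 1 ≤ N) (r k : ℕ) : Function.Injective (lagNode N r k) := by
  intro a b h
  have hN0 : (N : ℝ) ≠ 0 := by positivity
  have hr : (r : ℝ) + 1 ≠ 0 := by positivity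
  simp only [lagNode] at h
  rw [div_left_inj' hN0, add_right_inj, div_left_inj' hr] at h
  exact Fin.ext (by exact_mod_cast h)

theorem lagNode_mem {N k : ℕ} (hN : 1 ≤ N) (r : ℕ) (b : Fin (r + 1)) :
    0 ≤ lagNode N r k b ∧ lagNode N r k b ≤ 1 := by
  have hN0 : (0 : ℝ) < N := by positivity
  have hb : ((b : ℕ) : ℝ) / (r + 1) ≤ 1 := by
    rw [div_le_one (by positivity)]
    exact_mod_cast b.2.le
  refine ⟨by unfold lagNode; positivity, ?_⟩
  rw [lagNode, div_le_one hN0]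
  have : ((min k (N - 1) : ℕ) : ℝ) + 1 ≤ N := by exact_mod_cast (by omega)
  linarith

theorem abs_lagNode_sub_le {N k : ℕ} (hN : 1 ≤ N) (hk : k ≤ N) (r : ℕ) (b : Fin (r + 1)) :
    |lagNode N r k b - k / N| ≤ 1 / N := by
  have hN0 : (0 : ℝ) < N := by positivity
  have hb : ((b : ℕ) : ℝ) / (r + 1) ≤ 1 := by
    rw [div_le_one (by positivity)]
    exact_mod_cast b.2.le
  have hb0 : (0 : ℝ) ≤ ((b : ℕ) : ℝ) / (r + 1) := by positivity
  rw [lagNode, ← sub_div, abs_div, abs_of_pos hN0]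
  gcongr
  have h1 : ((min k (N - 1) : ℕ) : ℝ) ≤ k := by exact_mod_cast min_le_left _ _
  have h2 : (k : ℝ) ≤ (min k (N - 1) : ℕ) + 1 := by exact_mod_cast (by omega)
  exact abs_le.2 ⟨by linarith, by linarith⟩

theorem sum_eval_mul_lagBasis {N : ℕ} (hN : 1 ≤ N) {r : ℕ} (k : ℕ) {p : Polynomial ℝ}
    (hp : p.natDegree ≤ r) (t : ℝ) :
    ∑ a, p.eval (lagNode N r k a) * lagBasis N r k a t = p.eval t := by
  have h := Lagrange.eq_interpolate (s := Finset.univ) (v := lagNode N r k) (f := p)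
    (lagNode_injective hN r k).injOn
    (by
      rw [Finset.card_univ, Fintype.card_fin]
      exact (Polynomial.degree_le_of_natDegree_le hp).trans_lt (by exact_mod_cast Nat.lt_succ_self r))
  conv_rhs => rw [h]
  rw [Lagrange.interpolate_apply, Polynomial.eval_finsetSum]
  refine Finset.sum_congr rfl fun a _ => ?_
  rw [Polynomial.eval_mul, Polynomial.eval_C, lagBasis, Lagrange.basis, Polynomial.eval_prod]
  simp [Lagrange.basisDivisor]

/-- Polynomial functions of degree at most `r` in each variable. -/
def tensorPoly (d r : ℕ) : Submodule ℝ ((Fin d → ℝ) → ℝ) :=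
  Submodule.span ℝ {P | ∃ g : Fin d → Polynomial ℝ, (∀ c, (g c).natDegree ≤ r) ∧
    P = fun x => ∏ c, (g c).eval (x c)}

theorem sum_mul_prod_lagBasis {d N r : ℕ} (hN : 1 ≤ N) (k : Fin d → ℕ) {P : (Fin d → ℝ) → ℝ}
    (hP : P ∈ tensorPoly d r) (x : Fin d → ℝ) :
    ∑ a : Fin d → Fin (r + 1), P (fun c => lagNode N r (k c) (a c)) *
      ∏ c, lagBasis N r (k c) (a c) (x c) = P x := by
  induction hP using Submodule.span_induction with
  | mem P h =>
    obtain ⟨g, hg, rfl⟩ := h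
    simp only [← fun c => sum_eval_mul_lagBasis hN (k c) (hg c) (x c), Finset.prod_univ_sum,
      Fintype.piFinset_univ, Finset.prod_mul_distrib]
  | zero => simp
  | add P Q _ _ h1 h2 =>
    simp only [Pi.add_apply, add_mul, Finset.sum_add_distrib, h1, h2]
  | smul c P _ h =>
    simp only [Pi.smul_apply, smul_eq_mul, mul_assoc, ← Finset.mul_sum, h]

/-- The local basis functions: tensor hats times tensor Lagrange polynomials. -/
noncomputable def localBasis {d : ℕ} (N r : ℕ) (k : Fin d → ℕ) (a : Fin d → Fin (r + 1))
    (x : Fin d → ℝ) : ℝ :=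
  tensorHat N k x * ∏ c, lagBasis N r (k c) (a c) (x c)

/-- The coefficients are values of the polynomials at nodes of the cube, so pointwise estimates
bound them directly. -/
theorem sum_tensorHat_mul_eq {d N r : ℕ} (hN : 1 ≤ N) {P : Grid d N → (Fin d → ℝ) → ℝ}
    (hP : ∀ k, P k ∈ tensorPoly d r) (x : Fin d → ℝ) :
    ∑ k : Grid d N, tensorHat N (fun c => k c) x * P k x =
      ∑ z : Grid d N × (Fin d → Fin (r + 1)), P z.1 (fun c => lagNode N r (z.1 c) (z.2 c)) *
        localBasis N r (fun c => z.1 c) z.2 x := by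
  rw [Fintype.sum_prod_type]
  refine Finset.sum_congr rfl fun k _ => ?_
  rw [← sum_mul_prod_lagBasis hN (fun c => k c) (hP k) x, Finset.mul_sum]
  exact Finset.sum_congr rfl fun a _ => by rw [localBasis]; ring

/-! ### Networks for the local basis functions -/

/-- Truncation to `[-1, 1]`. -/
noncomputable def clampOne (t : ℝ) : ℝ := max (t + 1) 0 - max (t - 1) 0 - 1

theorem abs_clampOne_le (t : ℝ) : |clampOne t| ≤ 1 := by
  simp only [clampOne]
  refine abs_le.2 ⟨?_, ?_⟩ <;> rcases max_cases (t + 1) 0 with h | h <;>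
    rcases max_cases (t - 1) 0 with h' | h' <;> linarith

theorem clampOne_of_abs_le {t : ℝ} (h : |t| ≤ 1) : clampOne t = t := by
  have := abs_le.1 h
  rw [clampOne, max_eq_left (by linarith), max_eq_right (by linarith)]
  ring

/-- The factors, with values in `[-1, 1]`, of the local basis functions. -/
noncomputable def localFactor {d : ℕ} (N r : ℕ) (k : Fin d → ℕ) (a : Fin d → Fin (r + 1)) :
    Fin d × Option (Fin (r + 1)) → (Fin d → ℝ) → ℝ
  | (c, none), x => hat (N * x c - k c)
  -- The index omitted from the Lagrange product becomes a factor 1, so every basis function has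
  -- exactly d(r+2) factors. The clamp and the offset are each at most one in modulus; the scale 1/3
  -- is undone by `localConst`.
  | (c, some b), x => if b = a c then 1 else
      1 / 3 * (clampOne (N * x c - k c) + (k c - (min (k c) (N - 1) : ℕ) - (b : ℕ) / (r + 1)))

theorem offset_mem {N k r : ℕ} (hk : k ≤ N) (b : Fin (r + 1)) :
    |(k : ℝ) - (min k (N - 1) : ℕ) - (b : ℕ) / (r + 1)| ≤ 1 := by
  have hb : ((b : ℕ) : ℝ) / (r + 1) ≤ 1 := by
    rw [div_le_one (by positivity)]
    exact_mod_cast b.2.le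
  have hb0 : (0 : ℝ) ≤ ((b : ℕ) : ℝ) / (r + 1) := by positivity
  have h1 : ((min k (N - 1) : ℕ) : ℝ) ≤ k := by exact_mod_cast min_le_left _ _
  have h2 : (k : ℝ) ≤ (min k (N - 1) : ℕ) + 1 := by exact_mod_cast (by omega)
  exact abs_le.2 ⟨by linarith, by linarith⟩

theorem abs_localFactor_le {d N r : ℕ} {k : Fin d → ℕ} (hk : ∀ c, k c ≤ N)
    (a : Fin d → Fin (r + 1)) (i : Fin d × Option (Fin (r + 1))) (x : Fin d → ℝ) :
    |localFactor N r k a i x| ≤ 1 := by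
  obtain ⟨c, _ | b⟩ := i
  · simp only [localFactor]
    rw [abs_of_nonneg (hat_nonneg _)]
    exact hat_le_one _
  · simp only [localFactor]
    split_ifs
    · simp
    · have h1 := abs_le.1 (abs_clampOne_le (N * x c - k c))
      have h2 := abs_le.1 (offset_mem (hk c) b)
      exact abs_le.2 ⟨by linarith, by linarith⟩

/-- The normalisation constant of the local basis functions. -/
noncomputable def localConst {d : ℕ} (N r : ℕ) (k : Fin d → ℕ) (a : Fin d → Fin (r + 1)) : ℝ :=
  ∏ c, ∏ b ∈ Finset.univ.erase (a c),
    3 * (N * (lagNode N r (k c) (a c) - lagNode N r (k c) b))⁻¹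

/-- After scaling by `N`, distinct nodes are at least 1/(r+1) apart, which makes the bound
independent of `N`. -/
theorem abs_localConst_le {d N : ℕ} (hN : 1 ≤ N) (r : ℕ) (k : Fin d → ℕ)
    (a : Fin d → Fin (r + 1)) : |localConst N r k a| ≤ ((3 * (r + 1)) ^ r) ^ d := by
  have hN0 : (N : ℝ) ≠ 0 := by positivity
  have h : ∀ c, |∏ b ∈ Finset.univ.erase (a c),
      3 * (N * (lagNode N r (k c) (a c) - lagNode N r (k c) b))⁻¹| ≤ (3 * (r + 1) : ℝ) ^ r := by
    intro c
    rw [Finset.abs_prod]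
    have hcard : (Finset.univ.erase (a c)).card = r := by simp
    calc _ ≤ ∏ b ∈ Finset.univ.erase (a c), (3 * (r + 1) : ℝ) := by
          refine Finset.prod_le_prod (fun _ _ => abs_nonneg _) fun b hb => ?_
          have hne : ((a c : ℕ) : ℤ) - ((b : ℕ) : ℤ) ≠ 0 := by
            have := Finset.ne_of_mem_erase hb
            intro h0
            exact this (Fin.ext (by omega))
          have h1 : (1 : ℝ) ≤ |((a c : ℕ) : ℝ) - ((b : ℕ) : ℝ)| := by
            exact_mod_cast Int.one_le_abs hne
          have e : (N : ℝ) * (lagNode N r (k c) (a c) - lagNode N r (k c) b) =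
              (((a c : ℕ) : ℝ) - ((b : ℕ) : ℝ)) / (r + 1) := by
            simp only [lagNode]
            field_simp
            ring
          rw [e, inv_div, abs_mul, abs_div, abs_of_pos (by norm_num : (0 : ℝ) < 3),
            abs_of_pos (by positivity : (0 : ℝ) < r + 1)]
          gcongr
          exact div_le_self (by positivity) h1
      _ = _ := by rw [Finset.prod_const, hcard]
  rw [localConst, Finset.abs_prod]
  calc _ ≤ ∏ _c : Fin d, (3 * (r + 1) : ℝ) ^ r :=
        Finset.prod_le_prod (fun _ _ => abs_nonneg _) fun c _ => h c
    _ = _ := by simp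

/-- Where the hat is nonzero the clamp is inactive; elsewhere both sides vanish. -/
theorem localBasis_eq {d N : ℕ} (hN : 1 ≤ N) (r : ℕ) (k : Fin d → ℕ)
    (a : Fin d → Fin (r + 1)) (x : Fin d → ℝ) :
    localBasis N r k a x = localConst N r k a * ∏ i, localFactor N r k a i x := by
  have hN0 : (N : ℝ) ≠ 0 := by positivity
  rw [localBasis, localConst, Fintype.prod_prod_type, tensorHat, ← Finset.prod_mul_distrib,
    ← Finset.prod_mul_distrib]
  refine Finset.prod_congr rfl fun c _ => ?_
  rw [Fintype.prod_option]
  simp only [localFactor]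
  by_cases h0 : hat (N * x c - k c) = 0
  · simp [h0]
  rw [clampOne_of_abs_le (abs_lt_one_of_hat_ne_zero h0).le, mul_left_comm]
  congr 1
  rw [← Finset.mul_prod_erase Finset.univ _ (Finset.mem_univ (a c)), if_pos rfl, one_mul,
    ← Finset.prod_mul_distrib, lagBasis]
  refine Finset.prod_congr rfl fun b hb => ?_
  rw [if_neg (Finset.ne_of_mem_erase hb), mul_inv]
  have e : 1 / 3 * (N * x c - k c + (k c - (min (k c) (N - 1) : ℕ) - (b : ℕ) / (r + 1))) =
      1 / 3 * (N * (x c - lagNode N r (k c) b)) := by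
    rw [lagNode]
    field_simp
    ring
  rw [e]
  field_simp

/-- The first layer of the networks for the local basis functions. -/
noncomputable def gridNeuron {d : ℕ} (N : ℕ) (k : Fin d → ℕ) (i : Fin d × Fin 3) (x : Fin d → ℝ) :
    ℝ :=
  max ((2 * N + 1 : ℝ)⁻¹ * (N * x i.1 + ((1 : ℝ) - k i.1 - (i.2 : ℕ)))) 0

theorem realizable_gridNeuron {d N : ℕ} {k : Fin d → ℕ} (hk : ∀ c, k c ≤ N) :
    Realizable (3 * d) 1 (Set.range (gridNeuron N k)) := by
  refine Realizable.input.layer ?_ ?_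
  · rw [← Set.image_univ]
    refine (Set.encard_image_le _ _).trans ?_
    simp [Set.encard_univ, mul_comm]
  · rintro f ⟨⟨c, e⟩, rfl⟩
    refine ⟨_, ((((AffineComb.of (S := Set.range fun (i : Fin d) (x : Fin d → ℝ) => x i)
      ⟨c, rfl⟩).smul N).add
      (.const ((1 : ℝ) - k c - (e : ℕ)))).smul (2 * N + 1 : ℝ)⁻¹).mono ?_, rfl⟩
    have hk' : (k c : ℝ) ≤ N := by exact_mod_cast hk c
    have he : ((e : ℕ) : ℝ) ≤ 2 := by exact_mod_cast (by omega : (e : ℕ) ≤ 2)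
    have h0 : |(1 : ℝ) - k c - (e : ℕ)| ≤ N + 1 := by
      have h1 : (0 : ℝ) ≤ k c := Nat.cast_nonneg _
      have h2 : (0 : ℝ) ≤ (e : ℕ) := Nat.cast_nonneg _
      exact abs_le.2 ⟨by linarith, by linarith⟩
    rw [abs_of_pos (by positivity), inv_mul_le_iff₀ (by positivity), Nat.abs_cast]
    linarith

theorem affineComb_relu {d N : ℕ} (k : Fin d → ℕ) (c : Fin d) (e : Fin 3) {s : ℝ}
    (hs : s = 1 - (e : ℕ)) :
    AffineComb (Set.range (gridNeuron N k)) (2 * N + 1)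
      (fun x => max (N * x c - k c + s) 0) := by
  have hp : (0 : ℝ) < 2 * N + 1 := by positivity
  convert ((AffineComb.of (S := Set.range (gridNeuron N k)) ⟨(c, e), rfl⟩).smul
    (2 * N + 1 : ℝ)).mono (n := 2 * N + 1) (by rw [abs_of_pos hp, mul_one]) using 2 with x
  rw [gridNeuron, mul_max_of_nonneg _ _ hp.le, mul_zero, mul_inv_cancel_left₀ hp.ne', hs]
  congr 1
  ring

theorem affineComb_localFactor {d N r : ℕ} (hN : 1 ≤ N) {k : Fin d → ℕ} (hk : ∀ c, k c ≤ N)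
    (a : Fin d → Fin (r + 1)) (i : Fin d × Option (Fin (r + 1))) :
    AffineComb (Set.range (gridNeuron N k)) (12 * N) (localFactor N r k a i) := by
  have hN1 : (1 : ℝ) ≤ N := by exact_mod_cast hN
  obtain ⟨c, b⟩ := i
  have h0 := affineComb_relu (N := N) k c 0 (s := 1) (by simp)
  have h1 := affineComb_relu (N := N) k c 1 (s := 0) (by simp)
  have h2 := affineComb_relu (N := N) k c 2 (s := -1) (by norm_num)
  match b with
  | none =>
    convert ((h0.sub (h1.smul 2)).add h2).mono (n := 12 * N) (by norm_num; linarith) using 2 with x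
    simp only [localFactor, hat_eq_relu, add_zero]
    ring_nf
  | some b =>
    by_cases hb : b = a c
    · have : localFactor N r k a (c, some b) = fun _ => 1 := by
        funext x
        simp [localFactor, hb]
      rw [this]
      exact AffineComb.const_of_le (by rw [abs_one]; linarith)
    · have h4 := offset_mem (hk c) b
      convert ((((h0.sub h2).sub (.const 1)).add (.const
        ((k c : ℝ) - (min (k c) (N - 1) : ℕ) - (b : ℕ) / (r + 1)))).smul (1 / 3)).mono
        (n := 12 * N) ?_ using 2 with x
      · simp only [localFactor, hb, clampOne, if_false]
        ring_nf
      · rw [abs_one, abs_of_pos (by norm_num)]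
        linarith

/-- The local basis functions are approximated by networks of logarithmic size. -/
theorem exists_localBasis_approx {d N : ℕ} (hN : 1 ≤ N) (r j : ℕ) {k : Fin d → ℕ}
    (hk : ∀ c, k c ≤ N) (a : Fin d → Fin (r + 1)) :
    ∃ S, Realizable (3 * d + d * (r + 2) * (4 * (j + 1))) (1 + d * (r + 2) * (2 * (j + 1))) S ∧
      ∃ P, AffineComb S
          (((3 * (r + 1)) ^ r) ^ d * ((6 * (j + 1)) ^ (d * (r + 2)) * (12 * N))) P ∧
        ∀ x, |P x - localBasis N r k a x| ≤
          ((3 * (r + 1)) ^ r) ^ d * ((d * (r + 2) : ℕ) * (1 / 4) ^ j) := by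
  have hN1 : (1 : ℝ) ≤ N := by exact_mod_cast hN
  obtain ⟨T, -, hT, P, hP, -, hPx⟩ := (realizable_gridNeuron hk).exists_prod j (m := 12 * N)
    (by linarith) Finset.univ (fun i _ => affineComb_localFactor hN hk a i)
    (fun i _ => abs_localFactor_le hk a i)
  have hcard : (Finset.univ : Finset (Fin d × Option (Fin (r + 1)))).card = d * (r + 2) := by
    simp
  rw [hcard, zero_add] at hT
  rw [hcard] at hP hPx
  have hc := abs_localConst_le hN r k a
  refine ⟨T, hT, _, (hP.smul (localConst N r k a)).mono ?_, fun x => ?_⟩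
  · exact mul_le_mul_of_nonneg_right hc (by positivity)
  · rw [localBasis_eq hN, ← mul_sub, abs_mul]
    exact mul_le_mul hc (hPx x) (abs_nonneg _) (by positivity)

/-! ### Taylor approximation on the cube -/

theorem uniqueDiffOn_unitCube (d : ℕ) : UniqueDiffOn ℝ (unitCube d) := by
  rw [unitCube, ← Set.pi_univ_Icc]
  exact UniqueDiffOn.univ_pi fun _ => uniqueDiffOn_Icc zero_lt_one

/-- Derivatives along a segment. -/
theorem iteratedDerivWithin_comp_segment {E : Type*} [NormedAddCommGroup E] [NormedSpace ℝ E]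
    {s : Set E} (hs : UniqueDiffOn ℝ s) {r : ℕ} {f : E → ℝ} (hf : ContDiffOn ℝ r f s) {p v : E}
    (hpv : ∀ t ∈ Set.Icc (0 : ℝ) 1, p + t • v ∈ s) {j : ℕ} (hj : j ≤ r) {t : ℝ}
    (ht : t ∈ Set.Icc (0 : ℝ) 1) :
    iteratedDerivWithin j (fun t : ℝ => f (p + t • v)) (Set.Icc 0 1) t =
      iteratedFDerivWithin ℝ j f s (p + t • v) (fun _ => v) := by
  induction j generalizing t with
  | zero => simp
  | succ j ih =>
    rw [iteratedDerivWithin_succ,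
      derivWithin_congr (fun u hu => ih (by omega) hu) (ih (by omega) ht)]
    have h1 : HasDerivWithinAt (fun t : ℝ => p + t • v) v (Set.Icc 0 1) t := by
      simpa using ((hasDerivWithinAt_id t (Set.Icc 0 1)).smul_const v).const_add p
    have h2 := ((hf.differentiableOn_iteratedFDerivWithin (m := j)
      (by exact_mod_cast hj) hs) _ (hpv t ht)).hasFDerivWithinAt
    have h3 := h2.comp_hasDerivWithinAt t h1 (fun u hu => hpv u hu)
    have h4 := (ContinuousMultilinearMap.apply ℝ (fun _ : Fin j => E) ℝ
      (fun _ => v)).hasFDerivAt.comp_hasDerivWithinAt t h3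
    have h5 := h4.derivWithin (uniqueDiffOn_Icc zero_lt_one t ht)
    rw [iteratedFDerivWithin_succ_apply_left]
    exact h5

/-- The Taylor polynomial of degree `r` at the point `p` of the unit cube. -/
noncomputable def taylorPoly {d : ℕ} (r : ℕ) (f : (Fin d → ℝ) → ℝ) (p x : Fin d → ℝ) : ℝ :=
  ∑ j ∈ Finset.range (r + 1), (j.factorial : ℝ)⁻¹ *
    ∑ i : Fin j → Fin d, partialDeriv i f p * ∏ l, (x (i l) - p (i l))

theorem iteratedFDerivWithin_apply_const {d j : ℕ} (f : (Fin d → ℝ) → ℝ) (p v : Fin d → ℝ) :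
    iteratedFDerivWithin ℝ j f (unitCube d) p (fun _ => v) =
      ∑ i : Fin j → Fin d, partialDeriv i f p * ∏ l, v (i l) := by
  have hv : v = ∑ c, v c • (Pi.single c 1 : Fin d → ℝ) := by
    ext c
    simp [Pi.single_apply]
  conv_lhs => rw [hv]
  rw [ContinuousMultilinearMap.map_sum]
  refine Finset.sum_congr rfl fun i _ => ?_
  rw [ContinuousMultilinearMap.map_smul_univ, smul_eq_mul, mul_comm, partialDeriv]

/-- A product of at most r linear factors contains each variable at most r times. -/
theorem taylorPoly_mem_tensorPoly {d : ℕ} (r : ℕ) (f : (Fin d → ℝ) → ℝ) (p : Fin d → ℝ) :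
    taylorPoly r f p ∈ tensorPoly d r := by
  have : taylorPoly r f p = ∑ j ∈ Finset.range (r + 1), (j.factorial : ℝ)⁻¹ •
      ∑ i : Fin j → Fin d, partialDeriv i f p • fun x : Fin d → ℝ => ∏ l, (x (i l) - p (i l)) := by
    funext x
    simp [taylorPoly]
  rw [this]
  refine Submodule.sum_mem _ fun j hj => Submodule.smul_mem _ _ <| Submodule.sum_mem _ fun i _ =>
    Submodule.smul_mem _ _ <| Submodule.subset_span
      ⟨fun c => (Polynomial.X - Polynomial.C (p c)) ^ (Finset.univ.filter fun l => i l = c).card,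
        fun c => ?_, ?_⟩
  · rw [Polynomial.natDegree_pow, Polynomial.natDegree_X_sub_C, mul_one]
    refine (Finset.card_filter_le _ _).trans ?_
    simpa [Nat.lt_succ_iff] using hj
  · funext x
    rw [← Finset.prod_fiberwise' Finset.univ i (fun c => x c - p c)]
    simp

/-- The estimates that membership in the Hölder class amounts to. -/
structure HolderBound {d : ℕ} (r : ℕ) (ν B : ℝ) (f : (Fin d → ℝ) → ℝ) : Prop where
  contDiffOn : ContDiffOn ℝ r f (unitCube d)
  abs_apply_le : ∀ x ∈ unitCube d, |f x| ≤ B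
  abs_sub_le : ∀ i : Fin r → Fin d, ∀ x ∈ unitCube d, ∀ y ∈ unitCube d,
    |partialDeriv i f x - partialDeriv i f y| ≤ B * d * ‖x - y‖ ^ ν

theorem sqrt_sum_sq_le {d : ℕ} (x y : Fin d → ℝ) : √(∑ j, (x j - y j) ^ 2) ≤ d * ‖x - y‖ := by
  have h : ∑ j, (x j - y j) ^ 2 ≤ (∑ j, |x j - y j|) ^ 2 := by
    simpa using Finset.sum_sq_le_sq_sum_of_nonneg (s := Finset.univ)
      (f := fun j => |x j - y j|) fun j _ => abs_nonneg _
  refine (Real.sqrt_le_sqrt h).trans ?_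
  rw [Real.sqrt_sq (Finset.sum_nonneg fun _ _ => abs_nonneg _)]
  calc _ ≤ ∑ _j : Fin d, ‖x - y‖ := Finset.sum_le_sum fun j _ => norm_le_pi_norm (x - y) j
    _ = _ := by simp

theorem holderBound_of_holderNorm_le {d r : ℕ} (hd : 1 ≤ d) {ν : ℝ} (hν : 0 < ν) (hν1 : ν ≤ 1)
    {B : ℝ≥0} {f : (Fin d → ℝ) → ℝ} (hf : ContDiffOn ℝ r f (unitCube d))
    (h : holderNorm r ν f ≤ B) : HolderBound r ν B f := by
  rw [holderNorm, max_le_iff] at h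
  simp only [iSup_le_iff, ← ENNReal.ofReal_coe_nnreal (p := B),
    ENNReal.ofReal_le_ofReal_iff B.coe_nonneg] at h
  obtain ⟨h1, h2⟩ := h
  refine ⟨hf, fun x hx => ?_, fun i x hx y hy => ?_⟩
  · simpa [partialDeriv] using h1 0 (Nat.zero_le _) (fun l => l.elim0) x hx
  · by_cases hxy : x = y
    · subst hxy
      simp only [sub_self, abs_zero, norm_zero]
      positivity
    · have hpos : 0 < √(∑ j, (x j - y j) ^ 2) := by
        rw [Real.sqrt_pos]
        obtain ⟨j, hj⟩ := Function.ne_iff.1 hxy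
        exact Finset.sum_pos' (fun _ _ => sq_nonneg _)
          ⟨j, Finset.mem_univ j, by have := sub_ne_zero.2 hj; positivity⟩
      have h3 := h2 i x hx y hy hxy
      rw [div_le_iff₀ (Real.rpow_pos_of_pos hpos ν)] at h3
      refine h3.trans ?_
      rw [mul_assoc]
      refine mul_le_mul_of_nonneg_left ?_ B.2
      have hd1 : (1 : ℝ) ≤ d := by exact_mod_cast hd
      calc _ ≤ (d * ‖x - y‖) ^ ν := Real.rpow_le_rpow hpos.le (sqrt_sum_sq_le x y) hν.le
        _ = (d : ℝ) ^ ν * ‖x - y‖ ^ ν := Real.mul_rpow (by positivity) (norm_nonneg _)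
        _ ≤ (d : ℝ) ^ (1 : ℝ) * ‖x - y‖ ^ ν := by
          gcongr
        _ = _ := by rw [Real.rpow_one]

theorem abs_sum_prod_le {d j : ℕ} {v : Fin d → ℝ} {g : (Fin j → Fin d) → ℝ} {b : ℝ}
    (hg : ∀ i, |g i| ≤ b) : |∑ i : Fin j → Fin d, g i * ∏ l, v (i l)| ≤ d ^ j * (b * ‖v‖ ^ j) := by
  calc _ ≤ ∑ i : Fin j → Fin d, |g i * ∏ l, v (i l)| := Finset.abs_sum_le_sum_abs _ _
    _ ≤ ∑ _i : Fin j → Fin d, b * ‖v‖ ^ j := by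
      refine Finset.sum_le_sum fun i _ => ?_
      rw [abs_mul, Finset.abs_prod]
      refine mul_le_mul (hg i) ?_ (Finset.prod_nonneg fun _ _ => abs_nonneg _)
        ((abs_nonneg _).trans (hg i))
      calc _ ≤ ∏ _l : Fin j, ‖v‖ :=
            Finset.prod_le_prod (fun _ _ => abs_nonneg _) fun l _ => norm_le_pi_norm v (i l)
        _ = _ := by simp
    _ = _ := by simp

/-- Taylor's theorem for functions in the Hölder class. -/
theorem HolderBound.abs_sub_taylorPoly_le {d r : ℕ} {ν B : ℝ} (hν : 0 < ν) (hB : 0 ≤ B)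
    {f : (Fin d → ℝ) → ℝ} (hf : HolderBound r ν B f) {p x : Fin d → ℝ} (hp : p ∈ unitCube d)
    (hx : x ∈ unitCube d) : |f x - taylorPoly r f p x| ≤ B * d ^ (r + 1) * ‖x - p‖ ^ (r + ν) := by
  -- Lagrange remainder of order r along the segment: subtracting the order r Taylor term leaves a
  -- difference of derivatives of order r, to which the Hölder bound applies. For r = 0 the point is
  -- `x` itself.
  obtain ⟨ξ, hξ, hξp, heq⟩ : ∃ ξ ∈ unitCube d, ‖ξ - p‖ ≤ ‖x - p‖ ∧ f x - taylorPoly r f p x =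
      (r.factorial : ℝ)⁻¹ * ∑ i : Fin r → Fin d,
        (partialDeriv i f ξ - partialDeriv i f p) * ∏ l, (x - p) (i l) := by
    cases r with
    | zero =>
      refine ⟨x, hx, le_rfl, ?_⟩
      simp [taylorPoly, partialDeriv]
    | succ n =>
      have hseg : ∀ t ∈ Set.Icc (0 : ℝ) 1, p + t • (x - p) ∈ unitCube d := fun t ht =>
        (convex_Icc (0 : Fin d → ℝ) 1).add_smul_sub_mem hp hx ht
      have hderiv := fun {j : ℕ} (hj : j ≤ n + 1) {t : ℝ} (ht : t ∈ Set.Icc (0 : ℝ) 1) =>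
        iteratedDerivWithin_comp_segment (uniqueDiffOn_unitCube d) hf.contDiffOn hseg hj ht
      have hφ : ContDiffOn ℝ (n + 1 : ℕ) (fun t : ℝ => f (p + t • (x - p))) (Set.Icc 0 1) :=
        hf.contDiffOn.comp (by fun_prop) hseg
      have hu : Set.uIcc (0 : ℝ) 1 = Set.Icc 0 1 := Set.uIcc_of_le zero_le_one
      obtain ⟨t, ht, h⟩ := taylor_mean_remainder_lagrange (f := fun t : ℝ => f (p + t • (x - p)))
        (x₀ := 0) (x := 1) (n := n) zero_ne_one
        (by rw [hu]; exact hφ.of_le (by exact_mod_cast n.le_succ))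
        (by
          rw [hu]
          exact (hφ.differentiableOn_iteratedDerivWithin (by exact_mod_cast n.lt_succ_self)
            (uniqueDiffOn_Icc zero_lt_one)).mono
            (by
              rw [Set.uIoo_of_le zero_le_one]
              exact Set.Ioo_subset_Icc_self))
      rw [Set.uIoo_of_le zero_le_one] at ht
      have ht' : t ∈ Set.Icc (0 : ℝ) 1 := Set.Ioo_subset_Icc_self ht
      refine ⟨p + t • (x - p), hseg t ht', ?_, ?_⟩
      · rw [add_sub_cancel_left, norm_smul, Real.norm_of_nonneg ht'.1]
        exact mul_le_of_le_one_left (norm_nonneg _) ht'.2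
      · rw [hu, taylor_within_apply, hderiv le_rfl ht', iteratedFDerivWithin_apply_const] at h
        have h0 : ∀ j ∈ Finset.range (n + 1), ((j.factorial : ℝ)⁻¹ * (1 - 0) ^ j) •
            iteratedDerivWithin j (fun t : ℝ => f (p + t • (x - p))) (Set.Icc 0 1) 0 =
            (j.factorial : ℝ)⁻¹ *
              ∑ i : Fin j → Fin d, partialDeriv i f p * ∏ l, (x (i l) - p (i l)) := by
          intro j hj
          rw [hderiv (by rw [Finset.mem_range] at hj; omega) (by simp),
            iteratedFDerivWithin_apply_const]
          simp
        rw [Finset.sum_congr rfl h0] at h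
        simp only [one_smul, add_sub_cancel, sub_zero, one_pow, mul_one] at h
        rw [taylorPoly, Finset.sum_range_succ, ← sub_sub, h]
        simp only [sub_mul, Finset.sum_sub_distrib, Pi.sub_apply]
        ring
  rw [heq, abs_mul]
  have hfac : |(r.factorial : ℝ)⁻¹| ≤ 1 := by
    rw [abs_of_nonneg (by positivity)]
    exact inv_le_one_of_one_le₀ (by exact_mod_cast Nat.factorial_pos r)
  have hb : ∀ i, |partialDeriv i f ξ - partialDeriv i f p| ≤ B * d * ‖x - p‖ ^ ν := fun i =>
    (hf.abs_sub_le i ξ hξ p hp).trans (by gcongr)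
  refine (mul_le_of_le_one_left (abs_nonneg _) hfac).trans ((abs_sum_prod_le hb).trans_eq ?_)
  rcases (norm_nonneg (x - p)).eq_or_lt with h0 | h0
  · rw [← h0, Real.zero_rpow hν.ne', Real.zero_rpow (by positivity)]
    ring
  · rw [Real.rpow_add h0, Real.rpow_natCast]
    ring

/-! ### Two-scale expansion -/

/-- The grid point with index `k`. -/
noncomputable def gridPoint {d : ℕ} (N : ℕ) (k : Fin d → ℕ) (c : Fin d) : ℝ := k c / N

theorem gridPoint_mem {d N : ℕ} (k : Grid d N) : gridPoint N (fun c => k c) ∈ unitCube d := by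
  refine ⟨fun c => ?_, fun c => ?_⟩
  · simp only [gridPoint, Pi.zero_apply]
    positivity
  · exact div_le_one_of_le₀ (Nat.cast_le.2 (Nat.lt_succ_iff.1 (k c).2)) (Nat.cast_nonneg N)

theorem norm_sub_gridPoint_le {d N : ℕ} (hN : 1 ≤ N) {k : Fin d → ℕ} {x : Fin d → ℝ}
    (h : tensorHat N k x ≠ 0) : ‖x - gridPoint N k‖ ≤ 1 / N := by
  have hN0 : (0 : ℝ) < N := by exact_mod_cast hN
  refine (pi_norm_le_iff_of_nonneg (by positivity)).2 fun c => ?_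
  have h1 := (abs_lt_one_of_tensorHat_ne_zero h c).le
  have e : (N : ℝ) * x c - k c = (x c - gridPoint N k c) * N := by
    rw [gridPoint, sub_mul, div_mul_cancel₀ _ hN0.ne', mul_comm]
  rwa [e, abs_mul, abs_of_pos hN0, ← le_div_iff₀ hN0] at h1

theorem abs_sum_tensorHat_mul_le {d N : ℕ} (hN : 1 ≤ N) {x : Fin d → ℝ} (hx : x ∈ unitCube d)
    {g : Grid d N → ℝ} {δ : ℝ}
    (hg : ∀ k : Grid d N, tensorHat N (fun c => k c) x ≠ 0 → |g k| ≤ δ) :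
    |∑ k : Grid d N, tensorHat N (fun c => k c) x * g k| ≤ δ := by
  calc _ ≤ ∑ k : Grid d N, |tensorHat N (fun c => k c) x * g k| := Finset.abs_sum_le_sum_abs _ _
    _ ≤ ∑ k : Grid d N, tensorHat N (fun c => k c) x * δ := by
      refine Finset.sum_le_sum fun k _ => ?_
      rw [abs_mul, abs_of_nonneg (tensorHat_nonneg _ _)]
      by_cases h0 : tensorHat N (fun c => (k c : ℕ)) x = 0
      · simp [h0]
      · exact mul_le_mul_of_nonneg_left (hg k h0) (tensorHat_nonneg _ _)
    _ = δ := by rw [← Finset.sum_mul, sum_tensorHat hN hx, one_mul]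

theorem sum_tensorHat_mul_const {d N : ℕ} (hN : 1 ≤ N) {x : Fin d → ℝ} (hx : x ∈ unitCube d)
    (a : ℝ) : ∑ k : Grid d N, tensorHat N (fun c => k c) x * a = a := by
  rw [← Finset.sum_mul, sum_tensorHat hN hx, one_mul]

/-- Index set of the local basis functions of scale `N`. -/
abbrev LocalIndex (d N r : ℕ) : Type := Grid d N × (Fin d → Fin (r + 1))

/-- Approximation of functions in the Hölder class by local basis functions of the two scales `n`
and `n * n`, with small coefficients on the fine scale. -/
theorem HolderBound.exists_two_scale {d r : ℕ} {ν B : ℝ} (hν : 0 < ν) (hB : 0 ≤ B)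
    {f : (Fin d → ℝ) → ℝ} (hf : HolderBound r ν B f) {n : ℕ} (hn : 1 ≤ n) :
    ∃ (a : LocalIndex d n r → ℝ) (b : LocalIndex d (n * n) r → ℝ),
      (∀ z, |a z| ≤ B + B * d ^ (r + 1)) ∧
      (∀ z, |b z| ≤ B * d ^ (r + 1) * (1 + 2 ^ (r + ν)) * (1 / n : ℝ) ^ (r + ν)) ∧
      ∀ x ∈ unitCube d, |f x - ((∑ z, a z * localBasis n r (fun c => z.1 c) z.2 x) +
        ∑ z, b z * localBasis (n * n) r (fun c => z.1 c) z.2 x)| ≤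
          B * d ^ (r + 1) * (1 / (n * n : ℕ) : ℝ) ^ (r + ν) := by
  set N := n * n with hNdef
  have hN : 1 ≤ N := Nat.mul_pos hn hn
  have hn0 : (0 : ℝ) < n := by exact_mod_cast hn
  have hN0 : (0 : ℝ) < N := by exact_mod_cast hN
  have hnN : (1 : ℝ) / N ≤ 1 / n :=
    one_div_le_one_div_of_le hn0 (by exact_mod_cast Nat.le_mul_of_pos_left n hn)
  set A := B * d ^ (r + 1) with hA
  have hA0 : 0 ≤ A := by positivity
  have hτ : 0 ≤ r + ν := by positivity
  have taylor : ∀ {m : ℕ} (k : Grid d m) {x : Fin d → ℝ}, x ∈ unitCube d → ∀ {δ : ℝ},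
      ‖x - gridPoint m (fun c => k c)‖ ≤ δ →
      |f x - taylorPoly r f (gridPoint m (fun c => k c)) x| ≤ A * δ ^ (r + ν) := by
    intro m k x hx δ hδ
    exact (hf.abs_sub_taylorPoly_le hν hB (gridPoint_mem k) hx).trans (by gcongr)
  let T : Grid d n → (Fin d → ℝ) → ℝ := fun j => taylorPoly r f (gridPoint n fun c => j c)
  -- Fine Taylor polynomial minus the coarse approximation with its hats frozen at the fine grid
  -- point; freezing keeps this a polynomial.
  let R : Grid d N → (Fin d → ℝ) → ℝ := fun k =>
    taylorPoly r f (gridPoint N fun c => k c) -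
      ∑ j : Grid d n, tensorHat n (fun c => j c) (gridPoint N fun c => k c) • T j
  have hT : ∀ j, T j ∈ tensorPoly d r := fun j => taylorPoly_mem_tensorPoly _ _ _
  have hR : ∀ k, R k ∈ tensorPoly d r := fun k =>
    Submodule.sub_mem _ (taylorPoly_mem_tensorPoly _ _ _)
      (Submodule.sum_mem _ fun j _ => Submodule.smul_mem _ _ (hT j))
  have hRx : ∀ k x, R k x = taylorPoly r f (gridPoint N fun c => k c) x -
      ∑ j : Grid d n, tensorHat n (fun c => j c) (gridPoint N fun c => k c) * T j x := by
    intro k x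
    simp [R]
  have hnode : ∀ {m : ℕ} (hm : 1 ≤ m) (z : LocalIndex d m r),
      (fun c => lagNode m r (z.1 c) (z.2 c)) ∈ unitCube d := fun hm z =>
    ⟨fun c => (lagNode_mem hm r (z.2 c)).1, fun c => (lagNode_mem hm r (z.2 c)).2⟩
  refine ⟨fun z => T z.1 (fun c => lagNode n r (z.1 c) (z.2 c)),
    fun z => R z.1 (fun c => lagNode N r (z.1 c) (z.2 c)), fun z => ?_, fun z => ?_,
    fun x hx => ?_⟩
  · have hy := hnode hn z
    set y : Fin d → ℝ := fun c => lagNode n r (z.1 c) (z.2 c)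
    have h1 : ‖y - gridPoint n (fun c => z.1 c)‖ ≤ 1 := by
      refine (pi_norm_le_iff_of_nonneg zero_le_one).2 fun c => ?_
      have h2 := hy.1 c
      have h3 := hy.2 c
      have h4 := (gridPoint_mem z.1).1 c
      have h5 := (gridPoint_mem z.1).2 c
      simp only [Pi.zero_apply, Pi.one_apply] at h2 h3 h4 h5
      exact abs_le.2 ⟨by simp only [Pi.sub_apply]; linarith, by simp only [Pi.sub_apply]; linarith⟩
    have h2 := taylor z.1 hy h1
    rw [Real.one_rpow, mul_one, abs_sub_comm] at h2
    have h3 := hf.abs_apply_le y hy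
    have h4 := abs_sub_abs_le_abs_sub (T z.1 y) (f y)
    change |T z.1 y| ≤ _
    change |T z.1 y - f y| ≤ A at h2
    linarith
  · have hy := hnode hN z
    set y : Fin d → ℝ := fun c => lagNode N r (z.1 c) (z.2 c) with hydef
    have h1 : ‖y - gridPoint N (fun c => z.1 c)‖ ≤ 1 / N :=
      (pi_norm_le_iff_of_nonneg (by positivity)).2 fun c =>
        abs_lagNode_sub_le hN (Nat.lt_succ_iff.1 (z.1 c).2) r (z.2 c)
    have h2 := taylor z.1 hy (h1.trans hnN)
    -- A coarse point active at the fine grid point is within 1/n of it, hence within 2/n of the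
    -- node; this gives the factor 2^(r+ν).
    have h3 : |∑ j : Grid d n, tensorHat n (fun c => j c) (gridPoint N fun c => z.1 c) *
        (f y - T j y)| ≤ A * (2 * (1 / n)) ^ (r + ν) := by
      refine abs_sum_tensorHat_mul_le hn (gridPoint_mem z.1) fun j hj => taylor j hy ?_
      have h4 := norm_sub_gridPoint_le hn hj
      have h5 := norm_sub_le_norm_sub_add_norm_sub y (gridPoint N fun c => z.1 c)
        (gridPoint n fun c => j c)
      linarith
    simp only [mul_sub] at h3
    rw [Finset.sum_sub_distrib, sum_tensorHat_mul_const hn (gridPoint_mem z.1),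
      Real.mul_rpow (by norm_num) (by positivity)] at h3
    change |R z.1 y| ≤ _
    rw [hRx]
    have h6 := abs_le.1 h2
    have h7 := abs_le.1 h3
    refine abs_le.2 ⟨by linarith, by linarith⟩
  · have e1 := sum_tensorHat_mul_eq hn hT x
    have e2 := sum_tensorHat_mul_eq hN hR x
    rw [← e1, ← e2]
    -- Refinement undoes the freezing, so the coarse part cancels exactly.
    have e3 : ∑ k : Grid d N, tensorHat N (fun c => k c) x *
        ∑ j : Grid d n, tensorHat n (fun c => j c) (gridPoint N fun c => k c) * T j x =
        ∑ j : Grid d n, tensorHat n (fun c => j c) x * T j x := by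
      simp only [Finset.mul_sum, ← mul_assoc]
      rw [Finset.sum_comm]
      refine Finset.sum_congr rfl fun j _ => ?_
      rw [← Finset.sum_mul]
      congr 1
      exact tensorHat_refine hn hn _ hx
    have e4 : (∑ j : Grid d n, tensorHat n (fun c => j c) x * T j x) +
        ∑ k : Grid d N, tensorHat N (fun c => k c) x * R k x =
        ∑ k : Grid d N, tensorHat N (fun c => k c) x *
          taylorPoly r f (gridPoint N fun c => k c) x := by
      simp only [hRx, mul_sub]
      rw [Finset.sum_sub_distrib, e3]
      ring
    have e5 : f x - ∑ k : Grid d N, tensorHat N (fun c => k c) x *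
          taylorPoly r f (gridPoint N fun c => k c) x = ∑ k : Grid d N,
        tensorHat N (fun c => k c) x * (f x - taylorPoly r f (gridPoint N fun c => k c) x) := by
      simp only [mul_sub]
      rw [Finset.sum_sub_distrib, sum_tensorHat_mul_const hN hx]
    rw [e4, e5]
    exact abs_sum_tensorHat_mul_le hN hx fun k hk => taylor k hx (norm_sub_gridPoint_le hN hk)

/-! ### Assembling the network -/

/-- Linear combinations of functions approximated by networks are approximated by one network. -/
theorem Realizable.exists_sum {d w D : ℕ} {ι : Type*} [Fintype ι] {g : ι → (Fin d → ℝ) → ℝ}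
    {m e : ℝ} (hm : 0 ≤ m) (he : 0 ≤ e)
    (h : ∀ z, ∃ S, Realizable w (D + 1) S ∧ ∃ P, AffineComb S m P ∧ ∀ x, |P x - g z x| ≤ e) :
    -- The layer is chosen before the coefficients, so one layer serves all output components.
    ∃ S, Realizable (Fintype.card ι * w) (D + 1) S ∧ ∀ (a : ι → ℝ) (s : ℝ), ∑ z, |a z| ≤ s →
      ∃ P, AffineComb S (s * m) P ∧ ∀ x, |P x - ∑ z, a z * g z x| ≤ s * e := by
  choose S hS P hP hPx using h
  refine ⟨_, Realizable.iUnion Finset.univ fun z _ => hS z, fun a s hs =>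
    ⟨_, (AffineComb.sum Finset.univ fun z hz => ((hP z).subset
      (Set.subset_biUnion_of_mem (u := S) hz)).smul (a z)).mono ?_, fun x => ?_⟩⟩
  · rw [← Finset.sum_mul]
    exact mul_le_mul_of_nonneg_right hs hm
  · rw [← Finset.sum_sub_distrib]
    calc _ ≤ ∑ z, |a z * P z x - a z * g z x| := Finset.abs_sum_le_sum_abs _ _
      _ ≤ ∑ z, |a z| * e := Finset.sum_le_sum fun z _ => by
        rw [← mul_sub, abs_mul]
        exact mul_le_mul_of_nonneg_left (hPx z x) (abs_nonneg _)
      _ = (∑ z, |a z|) * e := by rw [Finset.sum_mul]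
      _ ≤ _ := mul_le_mul_of_nonneg_right hs he

theorem card_localIndex_le {d n : ℕ} (hn : 1 ≤ n) (r : ℕ) :
    (Fintype.card (LocalIndex d n r) : ℝ) ≤ (2 * (r + 1)) ^ d * (n : ℝ) ^ d := by
  have h : Fintype.card (LocalIndex d n r) = (n + 1) ^ d * (r + 1) ^ d := by simp
  rw [h, ← mul_pow, ← mul_pow]
  push_cast
  have : (1 : ℝ) ≤ n := by exact_mod_cast hn
  refine pow_le_pow_left₀ (by positivity) ?_ d
  nlinarith [Nat.cast_nonneg (α := ℝ) r]

/-- The network approximation with explicit parameters. -/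
theorem exists_mem_reluClass_of_holderBound {d r K : ℕ} (hd : 1 ≤ d) {ν θ B : ℝ} (hν : 0 < ν)
    (hθ0 : 0 ≤ θ) (hθ : θ ≤ 1) (hθν : θ ≤ r + ν) (hB : 0 ≤ B) {κ : (Fin d → ℝ) → Fin K → ℝ}
    (hκ : ∀ i, HolderBound r ν B (fun x => κ x i)) {n : ℕ} (hn : 1 ≤ n) (j : ℕ) {W D : ℕ}
    {M Q G : ℝ}
    (hQ : Q = (2 * (r + 1)) ^ d *
      (B + B * d ^ (r + 1) + B * d ^ (r + 1) * (1 + 2 ^ (r + ν))))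
    (hG : G = ((3 * (r + 1)) ^ r) ^ d)
    (hW : 2 * ((2 * (r + 1)) ^ d * ((n * n : ℕ) : ℝ) ^ d) *
      (3 * d + d * (r + 2) * (4 * (j + 1))) ≤ W)
    (hD : 1 + d * (r + 2) * (2 * (j + 1)) ≤ D)
    (hM : Q * ((n * n : ℕ) : ℝ) ^ d * (1 / n : ℝ) ^ θ *
      (G * ((6 * (j + 1)) ^ (d * (r + 2)) * (12 * (n * n : ℕ)))) ≤ M) :
    ∃ φ ∈ reluClass d K W D M, ∀ x ∈ unitCube d, ∀ i, |κ x i - φ x i| ≤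
      B * d ^ (r + 1) * (1 / (n * n : ℕ) : ℝ) ^ (r + ν) +
        Q * ((n * n : ℕ) : ℝ) ^ d * (G * ((d * (r + 2) : ℕ) * (1 / 4) ^ j)) := by
  set N := n * n with hNdef
  have hN : 1 ≤ N := Nat.mul_pos hn hn
  have hn1 : (1 : ℝ) ≤ n := by exact_mod_cast hn
  have hnN : n ≤ N := Nat.le_mul_of_pos_left n hn
  have hnNr : (n : ℝ) ≤ N := by exact_mod_cast hnN
  have hG0 : 0 ≤ G := by rw [hG]; positivity
  have hQ0 : 0 ≤ Q := by rw [hQ]; positivity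
  set A := B * (d : ℝ) ^ (r + 1) with hA
  have hA0 : 0 ≤ A := by positivity
  have hinv0 : (0 : ℝ) < 1 / n := by positivity
  have hinv1 : (1 : ℝ) / n ≤ 1 := by
    rw [div_le_one (by positivity)]
    exact hn1
  obtain ⟨S, hS, h⟩ := Realizable.exists_sum (d := d) (ι := LocalIndex d n r ⊕ LocalIndex d N r)
    (g := Sum.elim (fun z => localBasis n r (fun c => z.1 c) z.2)
      (fun z => localBasis N r (fun c => z.1 c) z.2))
    (w := 3 * d + d * (r + 2) * (4 * (j + 1))) (D := d * (r + 2) * (2 * (j + 1)))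
    (m := G * ((6 * (j + 1)) ^ (d * (r + 2)) * (12 * N)))
    (e := G * ((d * (r + 2) : ℕ) * (1 / 4) ^ j)) (by positivity) (by positivity) (by
      rw [add_comm (d * (r + 2) * (2 * (j + 1))) 1, hG]
      rintro (z | z)
      · obtain ⟨S, hS, P, hP, hPx⟩ := exists_localBasis_approx hn r j
          (fun c => Nat.lt_succ_iff.1 (z.1 c).2) z.2
        exact ⟨S, hS, P, hP.mono (by gcongr), hPx⟩
      · exact exists_localBasis_approx hN r j (fun c => Nat.lt_succ_iff.1 (z.1 c).2) z.2)
  have hcard1 := card_localIndex_le (d := d) hn r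
  have hcard2 := card_localIndex_le (d := d) hN r
  have hS' : Realizable W D S := by
    refine (hS.of_le (by omega)).mono ?_
    rw [← Nat.cast_le (α := ℝ)]
    refine le_trans ?_ hW
    rw [Fintype.card_sum]
    push_cast
    have : (2 * (r + 1) : ℝ) ^ d * (n : ℝ) ^ d ≤ (2 * (r + 1)) ^ d * (N : ℝ) ^ d := by gcongr
    gcongr
    push_cast at *
    linarith
  have key : ∀ i, ∃ P, AffineComb S M P ∧ ∀ x ∈ unitCube d, |κ x i - P x| ≤
      A * (1 / N : ℝ) ^ (r + ν) + Q * (N : ℝ) ^ d * (G * ((d * (r + 2) : ℕ) * (1 / 4) ^ j)) := by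
    intro i
    obtain ⟨a, b, ha, hb, hab⟩ := (hκ i).exists_two_scale hν hB hn
    have hsum : ∑ z, |Sum.elim a b z| ≤ Q * (N : ℝ) ^ d * (1 / n : ℝ) ^ θ := by
      rw [Fintype.sum_sum_type]
      simp only [Sum.elim_inl, Sum.elim_inr]
      have h1 : ∑ z, |a z| ≤ (2 * (r + 1)) ^ d * (n : ℝ) ^ d * (B + A) := by
        calc _ ≤ ∑ _z : LocalIndex d n r, (B + A) := Finset.sum_le_sum fun z _ => ha z
          _ = Fintype.card (LocalIndex d n r) * (B + A) := by
            rw [Finset.sum_const, nsmul_eq_mul, Finset.card_univ]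
          _ ≤ _ := by gcongr
      have h2 : ∑ z, |b z| ≤ (2 * (r + 1)) ^ d * (N : ℝ) ^ d *
          (A * (1 + 2 ^ (r + ν)) * (1 / n : ℝ) ^ (r + ν)) := by
        calc _ ≤ ∑ _z : LocalIndex d N r, (A * (1 + 2 ^ (r + ν)) * (1 / n : ℝ) ^ (r + ν)) :=
              Finset.sum_le_sum fun z _ => hb z
          _ = Fintype.card (LocalIndex d N r) * _ := by
            rw [Finset.sum_const, nsmul_eq_mul, Finset.card_univ]
          _ ≤ _ := by gcongr
      have h3 : (1 / n : ℝ) ^ (r + ν) ≤ (1 / n : ℝ) ^ θ :=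
        Real.rpow_le_rpow_of_exponent_ge hinv0 hinv1 hθν
      have h4 : (n : ℝ) ^ d ≤ (N : ℝ) ^ d * (1 / n : ℝ) ^ θ := by
        have h5 : (1 / n : ℝ) ^ (1 : ℝ) ≤ (1 / n : ℝ) ^ θ :=
          Real.rpow_le_rpow_of_exponent_ge hinv0 hinv1 hθ
        rw [Real.rpow_one] at h5
        have h6 : (n : ℝ) ≤ (n : ℝ) ^ d := le_self_pow₀ hn1 (by omega)
        calc (n : ℝ) ^ d = (n : ℝ) ^ d * n * (1 / n) := by field_simp
          _ ≤ (n : ℝ) ^ d * (n : ℝ) ^ d * (1 / n : ℝ) ^ θ := by gcongr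
          _ = _ := by rw [hNdef, Nat.cast_mul, mul_pow]
      calc _ ≤ (2 * (r + 1)) ^ d * ((N : ℝ) ^ d * (1 / n : ℝ) ^ θ) * (B + A) +
            (2 * (r + 1)) ^ d * (N : ℝ) ^ d *
              (A * (1 + 2 ^ (r + ν)) * (1 / n : ℝ) ^ θ) := by
            refine add_le_add (h1.trans ?_) (h2.trans ?_) <;> gcongr
        _ = _ := by rw [hQ]; ring
    obtain ⟨P, hP, hPx⟩ := h _ _ hsum
    refine ⟨P, hP.mono hM, fun x hx => ?_⟩
    have h1 := hab x hx
    have h2 := hPx x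
    rw [Fintype.sum_sum_type] at h2
    simp only [Sum.elim_inl, Sum.elim_inr] at h2
    have h3 : (1 / n : ℝ) ^ θ * (G * ((d * (r + 2) : ℕ) * (1 / 4) ^ j)) ≤
      G * ((d * (r + 2) : ℕ) * (1 / 4) ^ j) :=
      mul_le_of_le_one_left (by positivity) (Real.rpow_le_one hinv0.le hinv1 hθ0)
    have h4 := mul_le_mul_of_nonneg_left h3 (by positivity : 0 ≤ Q * (N : ℝ) ^ d)
    rw [abs_sub_comm] at h2
    have h5 := abs_sub_le (κ x i) _ (P x) |>.trans (add_le_add h1 h2)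
    refine h5.trans ?_
    linarith
  choose P hP hPx using key
  have hM0 : 0 ≤ M := le_trans (by positivity) hM
  exact ⟨_, hS'.exists_mem_reluClass hM0 hP, fun x hx i => hPx i x hx⟩

/-! ### From uniform to L² error, and choice of parameters -/

theorem l2CubeNorm_le {d K : ℕ} {g : (Fin d → ℝ) → Fin K → ℝ} {δ : ℝ} (hδ : 0 ≤ δ)
    (h : ∀ x ∈ unitCube d, ∀ i, |g x i| ≤ δ) : l2CubeNorm g ≤ ENNReal.ofReal (√K * δ) := by
  have hvol : volume (unitCube d) = 1 := by
    rw [unitCube, Real.volume_Icc_pi]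
    simp
  have hae : ∀ᵐ x ∂volume.restrict (unitCube d),
      ‖(WithLp.toLp 2 (g x) : EuclideanSpace ℝ (Fin K))‖ ≤ √K * δ := by
    refine (ae_restrict_mem measurableSet_Icc).mono fun x hx => ?_
    rw [EuclideanSpace.norm_eq, ← Real.sqrt_sq hδ, ← Real.sqrt_mul (Nat.cast_nonneg K)]
    refine Real.sqrt_le_sqrt ?_
    calc _ ≤ ∑ _i : Fin K, δ ^ 2 := Finset.sum_le_sum fun i _ => by
          rw [Real.norm_eq_abs]
          exact pow_le_pow_left₀ (abs_nonneg _) (h x hx i) 2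
      _ = _ := by simp
  refine (eLpNorm_le_of_ae_bound hae).trans_eq ?_
  simp [hvol]

theorem exists_mul_log_pow_le_rpow (a : ℝ) (k : ℕ) {η : ℝ} (hη : 0 < η) :
    ∃ M₀ : ℝ, Real.exp 1 ≤ M₀ ∧ ∀ M : ℝ, M₀ ≤ M → a * Real.log M ^ k ≤ M ^ η := by
  have h := (isLittleO_log_rpow_rpow_atTop (k : ℝ) hη).bound
    (show (0 : ℝ) < (|a| + 1)⁻¹ by positivity)
  obtain ⟨M₁, hM₁⟩ := Filter.eventually_atTop.1 h
  refine ⟨max (Real.exp 1) M₁, le_max_left _ _, fun M hM => ?_⟩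
  have h1 := hM₁ M ((le_max_right _ _).trans hM)
  have hM0 : Real.exp 1 ≤ M := (le_max_left _ _).trans hM
  have hpos : 0 < M := (Real.exp_pos 1).trans_le hM0
  have hlog : 0 ≤ Real.log M := Real.log_nonneg ((Real.one_le_exp zero_le_one).trans hM0)
  rw [Real.rpow_natCast, Real.norm_of_nonneg (by positivity), Real.norm_of_nonneg (by positivity),
    le_inv_mul_iff₀ (by positivity)] at h1
  refine le_trans ?_ h1
  gcongr
  linarith [le_abs_self a]

/-- The grid size used for the norm constraint `M`. -/
theorem exists_grid_size (d : ℕ) {M : ℝ} (hM : 1 ≤ M) :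
    ∃ n : ℕ, 1 ≤ n ∧ ((n * n : ℕ) : ℝ) ^ d ≤ M ^ ((d : ℝ) / (d + 1)) ∧
      ((n * n : ℕ) : ℝ) ^ (d + 1) ≤ M ∧
      (∀ θ : ℝ, 0 ≤ θ → θ ≤ 1 → (1 / n : ℝ) ^ θ * M ^ (θ / (2 * (d + 1))) ≤ 2) ∧
      (∀ τ : ℝ, 0 ≤ τ → (1 / (n * n : ℕ) : ℝ) ^ τ ≤ 4 ^ τ * M ^ (-τ / ((d : ℝ) + 1))) := by
  have hM0 : 0 < M := by linarith
  -- With n = ⌊x⌋ the fine grid size n² is about M^{1/(d+1)}; rounding loses at most a factor 2 in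
  -- n.
  set x : ℝ := M ^ (1 / (2 * ((d : ℝ) + 1))) with hx
  have hx1 : 1 ≤ x := Real.one_le_rpow hM (by positivity)
  have hx0 : 0 < x := by linarith
  have hn : 1 ≤ ⌊x⌋₊ := Nat.one_le_floor_iff _ |>.2 hx1
  have hnx : (⌊x⌋₊ : ℝ) ≤ x := Nat.floor_le hx0.le
  have hn1 : (1 : ℝ) ≤ ⌊x⌋₊ := by exact_mod_cast hn
  have hxn : x ≤ 2 * ⌊x⌋₊ := by linarith [Nat.lt_floor_add_one x]
  generalize ⌊x⌋₊ = n at *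
  have hn0 : (0 : ℝ) < n := by linarith
  have hpow : ∀ t : ℝ, x ^ t = M ^ (t / (2 * (d + 1))) := fun t => by
    rw [hx, ← Real.rpow_mul hM0.le]
    ring_nf
  have hNx : ∀ k : ℕ, ((n * n : ℕ) : ℝ) ^ k ≤ M ^ ((k : ℝ) / (d + 1)) := fun k => by
    calc ((n * n : ℕ) : ℝ) ^ k ≤ (x * x) ^ k := by
          push_cast
          gcongr
      _ = x ^ ((2 * k : ℕ) : ℝ) := by
        rw [Real.rpow_natCast, pow_mul, sq]
      _ = _ := by
        rw [hpow]
        congr 1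
        push_cast
        field_simp
  refine ⟨n, hn, hNx d, ?_, fun θ hθ hθ1 => ?_, fun τ hτ => ?_⟩
  · have := hNx (d + 1)
    rwa [Nat.cast_add, Nat.cast_one, div_self (by positivity), Real.rpow_one] at this
  · rw [← hpow, ← Real.mul_rpow (by positivity) hx0.le]
    have h1 : 1 / (n : ℝ) * x ≤ 2 := by
      rw [one_div, inv_mul_le_iff₀ hn0]
      linarith
    calc _ ≤ (2 : ℝ) ^ θ := Real.rpow_le_rpow (by positivity) h1 hθ
      _ ≤ (2 : ℝ) ^ (1 : ℝ) := Real.rpow_le_rpow_of_exponent_le (by norm_num) hθ1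
      _ = 2 := Real.rpow_one 2
  · have h1 : 1 / ((n * n : ℕ) : ℝ) ≤ 4 * (x ^ (-2 : ℝ)) := by
      rw [Real.rpow_neg hx0.le, Real.rpow_two, ← div_eq_mul_inv,
        div_le_div_iff₀ (by positivity) (by positivity)]
      push_cast
      nlinarith
    calc _ ≤ (4 * x ^ (-2 : ℝ)) ^ τ := Real.rpow_le_rpow (by positivity) h1 hτ
      _ = 4 ^ τ * x ^ (-2 * τ) := by
        rw [Real.mul_rpow (by norm_num) (by positivity), Real.rpow_mul hx0.le]
      _ = _ := by
        rw [hpow]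
        congr 2
        field_simp

/-- The number of folding steps used for the norm constraint `M`. -/
theorem exists_fold_depth (q : ℕ) (hq : 1 ≤ q) {M : ℝ} (hM : Real.exp 1 ≤ M) :
    ∃ j : ℕ, (j : ℝ) + 1 ≤ 3 * q * Real.log M ∧ (1 / 4 : ℝ) ^ j ≤ M ^ (-(q : ℝ)) := by
  have hM0 : 0 < M := (Real.exp_pos 1).trans_le hM
  have hL : 1 ≤ Real.log M := (Real.le_log_iff_exp_le hM0).2 hM
  have hq1 : (1 : ℝ) ≤ q := by exact_mod_cast hq
  refine ⟨q * ⌈Real.log M⌉₊, ?_, ?_⟩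
  · have h1 := (Nat.ceil_lt_add_one (by linarith : 0 ≤ Real.log M)).le
    push_cast
    have h2 : (q : ℝ) * ⌈Real.log M⌉₊ ≤ q * (Real.log M + 1) := by gcongr
    nlinarith
  · have h1 : (1 / 4 : ℝ) ≤ Real.exp (-1) := by
      rw [Real.exp_neg, one_div]
      exact inv_anti₀ (Real.exp_pos 1) (by linarith [Real.exp_one_lt_d9])
    calc (1 / 4 : ℝ) ^ (q * ⌈Real.log M⌉₊) ≤ Real.exp (-1) ^ (q * ⌈Real.log M⌉₊) := by gcongr
      _ = Real.exp (-(q * ⌈Real.log M⌉₊)) := by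
        rw [← Real.exp_nat_mul]
        push_cast
        ring_nf
      _ ≤ Real.exp (-(q * Real.log M)) := by
        gcongr
        exact Nat.le_ceil _
      _ = M ^ (-(q : ℝ)) := by
        rw [Real.rpow_def_of_pos hM0]
        ring_nf

theorem mainTheorem3 (d : ℕ) (hd : 1 ≤ d) (r : ℕ) (ν τ : ℝ) (hν : 0 < ν) (hν1 : ν ≤ 1)
    (hτ : τ = r + ν) (B : ℝ≥0) :
    ∃ c C : ℝ, 0 < c ∧ 0 < C ∧
      ∀ (K : ℕ) (κ : (Fin d → ℝ) → Fin K → ℝ), κ ∈ holderClass r ν d K B →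
      ∀ (M : ℝ), 0 < M →
      ∀ (W D : ℕ), c * (M ^ ((d : ℝ) / (d + 1)) * Real.log M) ≤ W → c * Real.log M ≤ D →
      ∃ φ ∈ reluClass d K W D M,
        l2CubeNorm (fun x => κ x - φ x) ≤
          ENNReal.ofReal (C * (√K * M ^ (-τ / ((d : ℝ) + 1)))) := by
  have hτ0 : 0 < τ := by rw [hτ]; positivity
  set θ := min τ 1 with hθ
  have hθ0 : 0 < θ := lt_min hτ0 one_pos
  set A := (B : ℝ) * (d : ℝ) ^ (r + 1) with hA
  obtain ⟨Q, hQ⟩ : ∃ Q : ℝ, Q = (2 * (r + 1)) ^ d *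
    (B + B * d ^ (r + 1) + B * d ^ (r + 1) * (1 + 2 ^ (r + ν))) := ⟨_, rfl⟩
  obtain ⟨G, hG⟩ : ∃ G : ℝ, G = ((3 * (r + 1)) ^ r) ^ d := ⟨_, rfl⟩
  have hA0 : 0 ≤ A := by positivity
  have hQ0 : 0 ≤ Q := by rw [hQ]; positivity
  have hG0 : 0 ≤ G := by rw [hG]; positivity
  set p := d * (r + 2) with hp
  -- Beyond this threshold the gain n^{-θ} pays for the logarithms: 24 is 12 times the rounding loss
  -- 2, and 18(r+2) log M bounds 6(j+1).
  obtain ⟨M₀, hM₀, hlog⟩ := exists_mul_log_pow_le_rpow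
    (24 * Q * G * (18 * (r + 2)) ^ p) p (η := θ / (2 * ((d : ℝ) + 1))) (by positivity)
  have hM₀pos : 0 < M₀ := (Real.exp_pos 1).trans_le hM₀
  set c₁ : ℝ := 2 * (2 * (r + 1)) ^ d * (3 * d + 12 * p * (r + 2)) with hc₁
  set c₂ : ℝ := 1 + 6 * p * (r + 2) with hc₂
  -- Grid error, multiplication error, the zero network for M < M₀, and 1 to make the constant
  -- positive.
  set C : ℝ := A * 4 ^ τ + Q * G * p + B * M₀ ^ (τ / ((d : ℝ) + 1)) + 1 with hC
  have hc₁0 : 0 ≤ c₁ := by positivity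
  have hc₂0 : 0 < c₂ := by positivity
  have hC0 : 0 < C := by positivity
  refine ⟨c₁ + c₂, C, by positivity, hC0, fun K κ hκ M hM W D hW hD => ?_⟩
  have hκ' : ∀ i, HolderBound r ν B (fun x => κ x i) := fun i =>
    holderBound_of_holderNorm_le hd hν hν1 (hκ i).1 (hκ i).2
  have hMτ : 0 < M ^ (-τ / ((d : ℝ) + 1)) := Real.rpow_pos_of_pos hM _
  suffices h : ∃ φ ∈ reluClass d K W D M, ∀ x ∈ unitCube d, ∀ i,
      |κ x i - φ x i| ≤ C * M ^ (-τ / ((d : ℝ) + 1)) by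
    obtain ⟨φ, hφ, hφx⟩ := h
    refine ⟨φ, hφ, ?_⟩
    rw [mul_left_comm]
    exact l2CubeNorm_le (by positivity) hφx
  rcases lt_or_ge M M₀ with hlt | hge
  · refine ⟨_, zero_mem_reluClass hM.le, fun x hx i => ?_⟩
    rw [sub_zero]
    have h1 : 1 ≤ M₀ ^ (τ / ((d : ℝ) + 1)) * M ^ (-τ / ((d : ℝ) + 1)) := by
      rw [neg_div, Real.rpow_neg hM.le, ← div_eq_mul_inv, one_le_div (by positivity)]
      exact Real.rpow_le_rpow hM.le hlt.le (by positivity)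
    calc |κ x i| ≤ B := (hκ' i).abs_apply_le x hx
      _ ≤ B * (M₀ ^ (τ / ((d : ℝ) + 1)) * M ^ (-τ / ((d : ℝ) + 1))) :=
        le_mul_of_one_le_right B.coe_nonneg h1
      _ = B * M₀ ^ (τ / ((d : ℝ) + 1)) * M ^ (-τ / ((d : ℝ) + 1)) := by ring
      _ ≤ _ := by
        gcongr
        have : 0 ≤ A * 4 ^ τ + Q * G * p := by positivity
        linarith
  · have hMe : Real.exp 1 ≤ M := hM₀.trans hge
    have hM1 : 1 ≤ M := (Real.one_le_exp zero_le_one).trans hMe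
    have hL : 1 ≤ Real.log M := (Real.le_log_iff_exp_le hM).2 hMe
    obtain ⟨n, hn, hNd, hNM, hnθ, hnτ⟩ := exists_grid_size d hM1
    -- The exponent r + 2 suffices: N^d ≤ M and τ ≤ r + 1 give N^d 4^{-j} ≤ M^{-(r+1)} ≤
    -- M^{-τ/(d+1)}.
    obtain ⟨j, hj, hj4⟩ := exists_fold_depth (r + 2) (by omega) hMe
    have hlogM := hlog M hge
    have hMd : 1 ≤ M ^ ((d : ℝ) / (d + 1)) := Real.one_le_rpow hM1 (by positivity)
    push_cast at hj
    have hex := exists_mem_reluClass_of_holderBound hd hν hθ0.le (min_le_right τ 1)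
      (hτ ▸ min_le_left _ _) B.coe_nonneg hκ' hn j (W := W) (D := D) (M := M) hQ hG ?_ ?_ ?_
    · obtain ⟨φ, hφ, hφx⟩ := hex
      refine ⟨φ, hφ, fun x hx i => (hφx x hx i).trans ?_⟩
      have h1 := hnτ τ hτ0.le
      have h2 : ((n * n : ℕ) : ℝ) ^ d * (1 / 4) ^ j ≤ M ^ (-τ / ((d : ℝ) + 1)) := by
        have hN1 : (1 : ℝ) ≤ (n * n : ℕ) := by exact_mod_cast Nat.mul_pos hn hn
        calc ((n * n : ℕ) : ℝ) ^ d * (1 / 4) ^ j ≤ M * M ^ (-((r + 2 : ℕ) : ℝ)) := by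
              gcongr
              exact (pow_le_pow_right₀ hN1 d.le_succ).trans hNM
          _ = M ^ (1 + -((r + 2 : ℕ) : ℝ)) := by rw [Real.rpow_add hM, Real.rpow_one]
          _ ≤ _ := by
            refine Real.rpow_le_rpow_of_exponent_le hM1 ?_
            have h3 : τ / ((d : ℝ) + 1) ≤ τ := div_le_self hτ0.le (by simp)
            push_cast
            rw [neg_div]
            linarith
      rw [← hτ, ← hp]
      calc _ ≤ A * (4 ^ τ * M ^ (-τ / ((d : ℝ) + 1))) +
            Q * G * p * (((n * n : ℕ) : ℝ) ^ d * (1 / 4) ^ j) := by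
            refine add_le_add (mul_le_mul_of_nonneg_left h1 hA0) (le_of_eq (by ring))
        _ ≤ A * (4 ^ τ * M ^ (-τ / ((d : ℝ) + 1))) + Q * G * p * M ^ (-τ / ((d : ℝ) + 1)) := by
            gcongr
        _ = (A * 4 ^ τ + Q * G * p) * M ^ (-τ / ((d : ℝ) + 1)) := by ring
        _ ≤ _ := by
          gcongr
          have : 0 ≤ B * M₀ ^ (τ / ((d : ℝ) + 1)) := by positivity
          linarith
    · refine le_trans ?_ hW
      have h1 : (3 * d + d * (r + 2) * (4 * (j + 1)) : ℝ) ≤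
          (3 * d + 12 * p * (r + 2)) * Real.log M := by
        have h2 : (d * (r + 2) : ℝ) = p := by rw [hp]; push_cast; ring
        rw [h2]
        have h3 : (p : ℝ) * (4 * (j + 1)) ≤ p * (4 * (3 * (r + 2) * Real.log M)) := by gcongr
        have h4 : (3 * d : ℝ) ≤ 3 * d * Real.log M := le_mul_of_one_le_right (by positivity) hL
        linarith
      calc _ ≤ 2 * ((2 * (r + 1)) ^ d * M ^ ((d : ℝ) / (d + 1))) *
            ((3 * d + 12 * p * (r + 2)) * Real.log M) := by gcongr
        _ = c₁ * (M ^ ((d : ℝ) / (d + 1)) * Real.log M) := by rw [hc₁]; ring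
        _ ≤ _ := by
          gcongr
          linarith
    · rw [← Nat.cast_le (α := ℝ)]
      refine le_trans ?_ hD
      rw [← hp]
      push_cast
      have h3 : (p : ℝ) * (2 * (j + 1)) ≤ p * (2 * (3 * (r + 2) * Real.log M)) := by gcongr
      calc _ ≤ Real.log M + p * (2 * (3 * (r + 2) * Real.log M)) := add_le_add hL h3
        _ = c₂ * Real.log M := by rw [hc₂]; ring
        _ ≤ _ := by
          gcongr
          linarith
    · rw [← hp]
      set y := M ^ (θ / (2 * ((d : ℝ) + 1))) with hy
      have hy0 : 0 < y := Real.rpow_pos_of_pos hM _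
      have h1 := hnθ θ hθ0.le (min_le_right _ _)
      have h2 : (6 * (j + 1) : ℝ) ^ p ≤ (18 * (r + 2)) ^ p * Real.log M ^ p := by
        rw [← mul_pow]
        refine pow_le_pow_left₀ (by positivity) ?_ p
        linarith
      -- After multiplication by `y`, the product of n^{-θ} and `y` is at most 2, and the logarithms
      -- are bounded by `y`.
      refine le_of_mul_le_mul_right ?_ hy0
      calc _ = 12 * Q * G * ((n * n : ℕ) : ℝ) ^ (d + 1) * ((1 / n : ℝ) ^ θ * y) *
            (6 * (j + 1) : ℝ) ^ p := by ring
        _ ≤ 12 * Q * G * M * 2 * ((18 * (r + 2)) ^ p * Real.log M ^ p) := by gcongr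
        _ = M * (24 * Q * G * (18 * (r + 2)) ^ p * Real.log M ^ p) := by ring
        _ ≤ M * y := by gcongr
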